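/- Let $M$ be a matroid on $[d]=\{1,\dots,d\}$ that is simple (no loops, no parallel elements) and of rank at most three. A \emph{line} of $M$ is a maximal dependent set all of whose three-element subsets are dependent; the \emph{degree} of a point (an element of $[d]$) is the number of lines containing it, and $Q_M$ is the set of points of degree at least three. \emph{Cactus configurations.} Call a matroid a line matroid if its independent sets are exactly the subsets of its ground set with at most two elements. Call a simple matroid of rank at most three with lines $l_1,\dots,l_n$ (distinct, $n\ge 1$) a cycle if there are distinct points $p_1,\dots,p_n$ such that the lines through $p_i$ are exactly the two distinct lines $l_i$ and $l_{i+1}$ (with $l_{n+1}=l_1$) and every other point lies on exactly one line. If $M'$ and $N$ are simple matroids of rank at most three, $p$ is a point of $M'$ and $q$ a point of $N$, their free gluing at $p,q$ is the simple matroid of rank at most three on the disjoint union of the two ground sets with $p$ and $q$ identified, whose lines are exactly the (images of the) lines of $M'$ and of $N$. A connected cactus configuration is a matroid obtained from a line matroid or a cycle by finitely many successive free gluings with line matroids or cycles. The connected components of $M$ are the restrictions of $M$ to the equivalence classes of points under the equivalence relation generated by lying on a common line, and $M$ is a \emph{cactus configuration} if each of its connected components is a connected cactus configuration. \emph{Varieties.}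 For a matroid $N$ on $[d]$ of rank at most three, let $\Gamma_N\subseteq(\mathbb C^3)^d$ be the set of all $(\gamma_1,\dots,\gamma_d)$ such that for every $I\subseteq[d]$, $I$ is dependent in $N$ if and only if the family $(\gamma_i)_{i\in I}$ is linearly dependent; let $V_N=\overline{\Gamma_N}$ be its Zariski closure; and let $V_{\mathcal C(N)}$ be the set of all $(\gamma_1,\dots,\gamma_d)$ such that $(\gamma_i)_{i\in I}$ is linearly dependent for every $I$ that is dependent in $N$. For $J\subseteq[d]$ let $M(J)$ be the matroid on $[d]$ obtained from $M$ by setting the points of $J$ to be loops, i.e. its independent sets are the independent sets of $M$ disjoint from $J$. \textbf{Theorem.} Let $M$ be a cactus configuration on $[d]$. Then $$V_{\mathcal C(M)}=\bigcup_{J\subseteq Q_M}V_{M(J)}.$$ Moreover, every irreducible component of $V_{\mathcal C(M)}$ (in the Zariski topology) is equal to $V_{M(J)}$ for some $J\subseteq Q_M$, and $V_{\mathcal C(M)}$ has at most $2^{|Q_M|}$ irreducible components. -/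

import Mathlib

namespace PointLine

open Set

variable {α : Type*}

/-! ### Simple matroids of rank at most three and their lines -/

/-- No loops and no parallel elements (`x = y` gives the loops). -/
def IsSimple (M : Matroid α) : Prop :=
  ∀ x y : α, ¬ M.IsCircuit {x, y}

/-- A line of `M`: a maximal one among the dependent sets all of whose three-element subsets
are dependent. -/
def IsLine (M : Matroid α) (l : Set α) : Prop :=
  Maximal (fun s : Set α => M.Dep s ∧ ∀ t ⊆ s, t.encard = 3 → M.Dep t) l

/-- The set of all lines of `M`. -/
def lines (M : Matroid α) : Set (Set α) :=
  {l | IsLine M l}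

/-- The set of lines of `M` containing the point `p`. -/
def linesThrough (M : Matroid α) (p : α) : Set (Set α) :=
  {l | IsLine M l ∧ p ∈ l}

/-- The points of `M` of degree at least three, i.e. lying on at least three lines. -/
def multiplePoints (M : Matroid α) : Set α :=
  {p | p ∈ M.E ∧ 3 ≤ (linesThrough M p).encard}

/-! ### Cactus configurations -/

/-- `M` is the uniform matroid of rank two on its ground set: the sets with at most two elements
are independent, and those with more than two elements are dependent. -/
def IsLineMatroid (M : Matroid α) : Prop :=
  ∀ I ⊆ M.E, (M.Indep I ↔ I.encard ≤ 2)

/-- `M` is a cycle: it has `n + 1` lines `l 0, …, l n` and distinct points `p 0, …, p n` such that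
the lines through `p i` are precisely the two lines `l i` and `l (i + 1)` (indices are cyclic,
as addition in `Fin (n + 1)` is), and every other point lies on exactly one line. -/
def IsCycleMatroid (M : Matroid α) : Prop :=
  IsSimple M ∧ M.eRank ≤ 3 ∧
  ∃ (n : ℕ) (p : Fin (n + 1) → α) (l : Fin (n + 1) → Set α),
    Function.Injective p ∧ (∀ i, p i ∈ M.E) ∧
    Function.Injective l ∧ range l = lines M ∧
    (∀ i, linesThrough M (p i) = {l i, l (i + 1)} ∧ (linesThrough M (p i)).encard = 2) ∧
    ∀ x ∈ M.E, x ∉ range p → (linesThrough M x).encard = 1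

/-- `K` is the free gluing of `M` and `N` at the point `P`. The two glued points have already been
given the common name `P`, and the ground sets are otherwise disjoint; `K` is the simple matroid
of rank at most three on the union of the ground sets whose lines are those of `M` and those
of `N`. (A simple matroid of rank at most three is determined by its ground set and its lines.) -/
def IsFreeGluing (M N : Matroid α) (P : α) (K : Matroid α) : Prop :=
  M.E ∩ N.E = {P} ∧ IsSimple K ∧ K.eRank ≤ 3 ∧ K.E = M.E ∪ N.E ∧ lines K = lines M ∪ lines N

/-- Connected cactus configurations: the matroids obtained from a line or a cycle by successive
free gluings with a line or a cycle. -/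
inductive IsConnectedCactus : Matroid α → Prop
  | base (N : Matroid α) (hN : IsLineMatroid N ∨ IsCycleMatroid N) : IsConnectedCactus N
  | glue (M N K : Matroid α) (P : α) (hM : IsConnectedCactus M)
      (hN : IsLineMatroid N ∨ IsCycleMatroid N) (hK : IsFreeGluing M N P K) :
      IsConnectedCactus K

/-- The connected component of `x` in the point-line configuration `M`: all points that can be
reached from `x` by steps between two points of a common line. -/
def component (M : Matroid α) (x : α) : Set α :=
  {y | Relation.ReflTransGen (fun a b => ∃ l, IsLine M l ∧ a ∈ l ∧ b ∈ l) x y}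

/-- Cactus configurations: each connected component is a connected cactus configuration. -/
def IsCactus (M : Matroid α) : Prop :=
  IsSimple M ∧ M.eRank ≤ 3 ∧ ∀ x ∈ M.E, IsConnectedCactus (M.restrict (component M x))

/-! ### The Zariski topology on the space of vector configurations -/

/-- Collections of vectors in `ℂ³` indexed by `α`. This is a type of its own, so that it carries
the Zariski topology and not the Euclidean one. -/
def Config (α : Type*) : Type _ := α → Fin 3 → ℂ

/-- The common zero set of a set of polynomials in the coordinates of the vectors. -/
def zeroSet (S : Set (MvPolynomial (α × Fin 3) ℂ)) : Set (Config α) :=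
  {γ | ∀ f ∈ S, MvPolynomial.eval (fun ij : α × Fin 3 => γ ij.1 ij.2) f = 0}

/-- The Zariski topology: the closed sets are the zero sets of sets of polynomials. -/
instance zariskiTopology (α : Type*) : TopologicalSpace (Config α) :=
  TopologicalSpace.ofClosed {Z | ∃ S : Set (MvPolynomial (α × Fin 3) ℂ), Z = zeroSet S}
    ⟨{1}, by ext γ; simp [zeroSet]⟩
    (by
      intro A hA
      refine ⟨{f | ∃ S, zeroSet S ∈ A ∧ f ∈ S}, ?_⟩
      ext γ
      constructor
      · rintro h f ⟨S, hS, hf⟩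
        exact h _ hS f hf
      · intro h Z hZ
        obtain ⟨S, rfl⟩ := hA hZ
        exact fun f hf => h f ⟨S, hZ, hf⟩)
    (by
      rintro _ ⟨S, rfl⟩ _ ⟨T, rfl⟩
      refine ⟨{f | ∃ g ∈ S, ∃ h ∈ T, f = g * h}, ?_⟩
      ext γ
      constructor
      · rintro (h | h) _ ⟨g, hg, k, hk, rfl⟩
        · simp [h g hg]
        · simp [h k hk]
      · intro h
        by_contra hcon
        simp only [mem_union, not_or] at hcon
        obtain ⟨h1, h2⟩ := hcon
        simp only [zeroSet, mem_ofPred_eq, not_forall] at h1 h2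
        obtain ⟨g, hg, hg0⟩ := h1
        obtain ⟨k, hk, hk0⟩ := h2
        have := h _ ⟨g, hg, k, hk, rfl⟩
        rw [map_mul] at this
        exact (mul_ne_zero hg0 hk0) this)

/-- The irreducible components of a subset `V` of the configuration space with its subspace
topology, as subsets of the configuration space. -/
def components (V : Set (Config α)) : Set (Set (Config α)) :=
  (fun Z : Set V => Subtype.val '' Z) '' irreducibleComponents V

/-! ### Matroid varieties and circuit varieties -/

/-- The realization space of `M`: a set of points is dependent in `M` if and only if the
corresponding family of vectors is linearly dependent. -/
def realizationSpace (M : Matroid α) : Set (Config α) :=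
  {γ | ∀ I ⊆ M.E, (M.Dep I ↔ ¬ LinearIndepOn ℂ (γ : α → Fin 3 → ℂ) I)}

/-- The matroid variety of `M`: the Zariski closure of the realization space. -/
def matroidVariety (M : Matroid α) : Set (Config α) :=
  closure (realizationSpace M)

/-- The circuit variety of `M`: the vector configurations including the dependencies of `M`. -/
def circuitVariety (M : Matroid α) : Set (Config α) :=
  {γ | ∀ I ⊆ M.E, M.Dep I → ¬ LinearIndepOn ℂ (γ : α → Fin 3 → ℂ) I}

/-- The matroid obtained from `M` by setting the points of `J` to be loops: `J` is deleted, and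
its points are put back as loops (restricting to a larger ground set adds the new points as
loops). -/
def setLoops (M : Matroid α) (J : Set α) : Matroid α :=
  (M.delete J).restrict M.E

theorem setLoops_ground (M : Matroid α) (J : Set α) : (setLoops M J).E = M.E := rfl

theorem setLoops_indep_iff (M : Matroid α) (J I : Set α) :
    (setLoops M J).Indep I ↔ M.Indep I ∧ Disjoint I J := by
  rw [setLoops, Matroid.restrict_indep_iff, Matroid.delete_indep_iff]
  exact ⟨fun h => h.1, fun h => ⟨h, h.1.subset_ground⟩⟩

end PointLine

/-! A configuration lies in the circuit variety exactly when the vectors on each line are orthogonal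
to a nonzero normal (`IsSimple.mem_circuitVariety_iff`). Choosing the normals gives an orthogonal
realization of the point-line incidence graph: adjacent vertices carry orthogonal vectors. Hence the
configurations of the circuit variety that vanish exactly on `J` are the projection of the nowhere
zero realizations of the graph with the points of `J` deleted (`exactConfigs_eq_image`).

For a cactus this graph is built by adding vertices with at most one earlier neighbour and attaching
even cycles of length at least six at one vertex (`IsCactus.isCactusSet`), and such graphs are
stable under deletion of vertices (`IsCactusSet.diff`). Both operations keep the set of realizations
irreducible (`IsCactusSet.isPreirreducible`). A vertex with at most one neighbour adds a punctured
linear fibre of constant dimension. For a cycle, the vertex that closes it has two neighbours; where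
these are not parallel its fibre is a punctured line, and deformations of the cycle show that this
locus is dense (`IsEar.subset_closure`).

The realization space of M(J) is cut out of the irreducible set `exactConfigs M J` by finitely many
open independence conditions. Each can be met by a configuration of coordinate vectors, so
irreducibility makes all of them hold together: the realization space is nonempty, irreducible and
dense. Hence `exactConfigs M J` lies in the matroid variety of M(J).

Finally, a zero vector at a point of degree at most two can be perturbed orthogonally to at most two
normals. So any configuration of the circuit variety is a limit of configurations vanishing exactly
at its zeros in Q_M (`mem_closure_exactConfigs`). The union formula follows, and the components are
among its finitely many irreducible closed members. -/

namespace PointLine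

open Set Topology Filter
open scoped Matrix

/-! ### Polynomial functions and the Zariski topology -/

section Zariski

variable {V W : Type*}

/-- A function on the configuration space that is given by a polynomial in the coordinates. -/
def IsPoly (F : Config V → ℂ) : Prop :=
  ∃ p : MvPolynomial (V × Fin 3) ℂ, ∀ γ : Config V,
    F γ = MvPolynomial.eval (fun ij : V × Fin 3 => γ ij.1 ij.2) p

theorem IsPoly.const (c : ℂ) : IsPoly (fun _ : Config V => c) :=
  ⟨MvPolynomial.C c, fun _ => by simp⟩

theorem IsPoly.coord (v : V) (i : Fin 3) : IsPoly (fun γ : Config V => γ v i) :=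
  ⟨MvPolynomial.X (v, i), fun _ => by simp⟩

theorem IsPoly.add {F G : Config V → ℂ} (hF : IsPoly F) (hG : IsPoly G) :
    IsPoly (fun γ => F γ + G γ) := by
  obtain ⟨p, hp⟩ := hF
  obtain ⟨q, hq⟩ := hG
  exact ⟨p + q, fun γ => by simp [hp, hq]⟩

theorem IsPoly.sub {F G : Config V → ℂ} (hF : IsPoly F) (hG : IsPoly G) :
    IsPoly (fun γ => F γ - G γ) := by
  obtain ⟨p, hp⟩ := hF
  obtain ⟨q, hq⟩ := hG
  exact ⟨p - q, fun γ => by simp [hp, hq]⟩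

theorem IsPoly.mul {F G : Config V → ℂ} (hF : IsPoly F) (hG : IsPoly G) :
    IsPoly (fun γ => F γ * G γ) := by
  obtain ⟨p, hp⟩ := hF
  obtain ⟨q, hq⟩ := hG
  exact ⟨p * q, fun γ => by simp [hp, hq]⟩

theorem IsPoly.sum {ι : Type*} (s : Finset ι) {F : ι → Config V → ℂ} (hF : ∀ i ∈ s, IsPoly (F i)) :
    IsPoly (fun γ => ∑ i ∈ s, F i γ) := by
  classical
  induction s using Finset.induction_on with
  | empty => simpa using IsPoly.const 0
  | insert a s ha ih =>
    simp only [Finset.sum_insert ha]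
    exact (hF a (by simp)).add (ih fun i hi => hF i (by simp [hi]))

theorem IsPoly.det {ι : Type*} [Fintype ι] [DecidableEq ι] {A : Config V → Matrix ι ι ℂ}
    (hA : ∀ i j, IsPoly (fun γ => A γ i j)) : IsPoly (fun γ => (A γ).det) := by
  choose p hp using hA
  refine ⟨(Matrix.of p).det, fun γ => ?_⟩
  rw [RingHom.map_det]
  exact congrArg Matrix.det (Matrix.ext fun i j => by simp [hp])

theorem isClosed_iff_zeroSet {Z : Set (Config V)} :
    IsClosed Z ↔ ∃ S : Set (MvPolynomial (V × Fin 3) ℂ), Z = zeroSet S := by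
  rw [← isOpen_compl_iff]
  change Zᶜᶜ ∈ {Z | ∃ S : Set (MvPolynomial (V × Fin 3) ℂ), Z = zeroSet S} ↔ _
  rw [compl_compl]
  rfl

theorem IsPoly.isOpen_ne {F : Config V → ℂ} (hF : IsPoly F) : IsOpen {γ | F γ ≠ 0} := by
  obtain ⟨p, hp⟩ := hF
  rw [← isClosed_compl_iff, isClosed_iff_zeroSet]
  refine ⟨{p}, ?_⟩
  ext γ
  simp [zeroSet, hp]

theorem exists_basic_of_isOpen {U : Set (Config V)} (hU : IsOpen U) {a : Config V} (ha : a ∈ U) :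
    ∃ p : MvPolynomial (V × Fin 3) ℂ,
      MvPolynomial.eval (fun ij : V × Fin 3 => a ij.1 ij.2) p ≠ 0 ∧
      ∀ γ : Config V, MvPolynomial.eval (fun ij : V × Fin 3 => γ ij.1 ij.2) p ≠ 0 → γ ∈ U := by
  obtain ⟨S, hS⟩ := isClosed_iff_zeroSet.1 (isClosed_compl_iff.2 hU)
  have h : a ∉ zeroSet S := by rw [← hS]; simpa using ha
  simp only [zeroSet, mem_ofPred_eq, not_forall] at h
  obtain ⟨p, hp, hp0⟩ := h
  refine ⟨p, hp0, fun γ hγ => ?_⟩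
  by_contra hc
  have : γ ∈ zeroSet S := by rw [← hS]; exact hc
  exact hγ (this p hp)

theorem continuous_of_isPoly {s : Config V → Config W}
    (hs : ∀ w i, IsPoly (fun γ => s γ w i)) : Continuous s := by
  choose q hq using hs
  rw [continuous_iff_isClosed]
  intro Z hZ
  obtain ⟨S, rfl⟩ := isClosed_iff_zeroSet.1 hZ
  rw [isClosed_iff_zeroSet]
  refine ⟨(fun p => MvPolynomial.bind₁ (fun ij : W × Fin 3 => q ij.1 ij.2) p) '' S, ?_⟩
  ext γ
  have key : ∀ p : MvPolynomial (W × Fin 3) ℂ,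
      MvPolynomial.eval (fun ij : V × Fin 3 => γ ij.1 ij.2)
        (MvPolynomial.bind₁ (fun ij : W × Fin 3 => q ij.1 ij.2) p) =
      MvPolynomial.eval (fun ij : W × Fin 3 => s γ ij.1 ij.2) p := by
    intro p
    simp only [hq]
    rw [← MvPolynomial.coe_aeval_eq_eval, ← MvPolynomial.coe_aeval_eq_eval]
    simp only [RingHom.coe_coe, MvPolynomial.aeval_bind₁]
  simp [zeroSet, key]

/-- The point with parameter `t` on the affine line through two configurations. -/
def linePoint (a b : Config V) (t : ℂ) : Config V :=
  fun v => (1 - t) • (a v : Fin 3 → ℂ) + t • (b v : Fin 3 → ℂ)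

/-- Each open set contains the nonvanishing locus of a polynomial that is nonzero at `a`,
respectively `b`. Restricted to the line these become nonzero polynomials in `t`, and their product
has a non-root. -/
theorem exists_linePoint_mem {U₁ U₂ : Set (Config V)} (h₁ : IsOpen U₁) (h₂ : IsOpen U₂)
    {a b : Config V} (ha : a ∈ U₁) (hb : b ∈ U₂) :
    ∃ t : ℂ, linePoint a b t ∈ U₁ ∩ U₂ := by
  obtain ⟨p, hp, hpU⟩ := exists_basic_of_isOpen h₁ ha
  obtain ⟨q, hq, hqU⟩ := exists_basic_of_isOpen h₂ hb
  let φ : MvPolynomial (V × Fin 3) ℂ → Polynomial ℂ := fun r =>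
    MvPolynomial.aeval (fun ij : V × Fin 3 =>
      (1 - Polynomial.X) * Polynomial.C (a ij.1 ij.2) + Polynomial.X * Polynomial.C (b ij.1 ij.2)) r
  have hφ : ∀ r t, (φ r).eval t =
      MvPolynomial.eval (fun ij : V × Fin 3 => linePoint a b t ij.1 ij.2) r := by
    intro r t
    simp only [φ]
    rw [← Polynomial.coe_aeval_eq_eval, MvPolynomial.comp_aeval_apply,
      ← MvPolynomial.coe_aeval_eq_eval]
    simp [linePoint, -Polynomial.X_mul_C]
  have e0 : linePoint a b 0 = a := by
    funext v; simp [linePoint]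
  have e1 : linePoint a b 1 = b := by
    funext v; simp [linePoint]
  have hp' : φ p ≠ 0 := by
    intro h
    apply hp
    have := hφ p 0
    rw [h, e0] at this
    simpa using this.symm
  have hq' : φ q ≠ 0 := by
    intro h
    apply hq
    have := hφ q 1
    rw [h, e1] at this
    simpa using this.symm
  obtain ⟨t, ht⟩ : ∃ t, (φ p * φ q).eval t ≠ 0 := by
    by_contra hc
    push Not at hc
    exact mul_ne_zero hp' hq' (Polynomial.funext fun t => by simpa using hc t)
  rw [Polynomial.eval_mul, hφ, hφ] at ht
  exact ⟨t, hpU _ (left_ne_zero_of_mul ht), hqU _ (right_ne_zero_of_mul ht)⟩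

/-- A limit in the Euclidean topology lies in the Zariski closure. -/
theorem mem_closure_of_curve {A : Set (Config V)} (γ : ℂ → V → Fin 3 → ℂ)
    (hγ : Continuous γ) (hA : ∀ᶠ t in 𝓝[≠] (0 : ℂ), (γ t : Config V) ∈ A) :
    (γ 0 : Config V) ∈ closure A := by
  by_contra hc
  obtain ⟨p, hp, hpU⟩ := exists_basic_of_isOpen (isOpen_compl_iff.2 isClosed_closure)
    (show (γ 0 : Config V) ∈ (closure A)ᶜ from hc)
  have hcont : Continuous (fun t => MvPolynomial.eval (fun ij : V × Fin 3 => γ t ij.1 ij.2) p) :=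
    (MvPolynomial.continuous_eval p).comp (by fun_prop)
  have hev : ∀ᶠ t in 𝓝[≠] (0 : ℂ),
      MvPolynomial.eval (fun ij : V × Fin 3 => γ t ij.1 ij.2) p ≠ 0 :=
    (hcont.continuousAt.eventually_ne hp).filter_mono nhdsWithin_le_nhds
  obtain ⟨t, h1, h2⟩ := (hA.and hev).exists
  exact hpU _ h2 (subset_closure h1)

/-- Near an independent `γ₀`, a left inverse `L` of its linear combination map gives a polynomial
certificate: det(L(γ i) j) equals 1 at `γ₀`, and where it is nonzero the vectors are independent. -/
theorem isOpen_linearIndepOn [Finite V] (I : Set V) :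
    IsOpen {γ : Config V | LinearIndepOn ℂ (γ : V → Fin 3 → ℂ) I} := by
  classical
  have := Fintype.ofFinite V
  rw [isOpen_iff_forall_mem_open]
  intro γ₀ hγ₀
  have h0 : LinearIndependent ℂ (fun i : I => γ₀ i) := hγ₀
  obtain ⟨L, hL⟩ := LinearMap.exists_leftInverse_of_injective
    (Fintype.linearCombination ℂ (fun i : I => (γ₀ i : Fin 3 → ℂ)))
    (LinearMap.ker_eq_bot.2 (linearIndependent_iff_injective_fintypeLinearCombination.1 h0))
  have hpoly : IsPoly (fun γ : Config V => (Matrix.of fun i j : I => L (γ i) j).det) := by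
    apply IsPoly.det
    intro i j
    have : ∀ γ : Config V, L (γ i) j = ∑ k, γ i k * L (Pi.single k 1) j := by
      intro γ
      conv_lhs => rw [← Finset.univ_sum_single (γ i), map_sum, Finset.sum_apply]
      refine Finset.sum_congr rfl fun k _ => ?_
      have : (Pi.single k (γ i k) : Fin 3 → ℂ) = γ i k • Pi.single k 1 := by
        rw [← Pi.single_smul]; simp
      rw [this, map_smul]; rfl
    simp only [Matrix.of_apply, this]
    exact IsPoly.sum _ fun k _ => (IsPoly.coord _ _).mul (IsPoly.const _)
  refine ⟨_, ?_, hpoly.isOpen_ne, ?_⟩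
  · intro γ hγ
    have h1 : LinearIndependent ℂ (fun i : I => L (γ i)) := by
      have := Matrix.linearIndependent_rows_of_det_ne_zero hγ
      exact this
    exact LinearIndependent.of_comp L h1
  · have : (Matrix.of fun i j : I => L (γ₀ i) j) = 1 := by
      ext i j
      have h := LinearMap.congr_fun hL (Pi.single i 1)
      simp only [LinearMap.comp_apply, Fintype.linearCombination_apply_single, one_smul,
        LinearMap.id_apply] at h
      rw [Matrix.of_apply, h, Matrix.one_apply, Pi.single_apply]
      simp [eq_comm]
    simp [this]

end Zariski

/-! ### Vectors in `ℂ³` -/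

section Vectors

variable {u v w x y z a b : Fin 3 → ℂ}

theorem exists_dotProduct_eq_one (hu : u ≠ 0) : ∃ c : Fin 3 → ℂ, c ⬝ᵥ u = 1 := by
  obtain ⟨i, hi⟩ := Function.ne_iff.1 hu
  have hi : u i ≠ 0 := hi
  exact ⟨Pi.single i (u i)⁻¹, by simp [hi]⟩

/-- Take c with c · u = 1 in the identity c × (u × v) = (c · v) u − (c · u) v; the proof checks it
by coordinates. -/
theorem exists_smul_of_cross_eq_zero (hu : u ≠ 0) (h : crossProduct u v = 0) :
    ∃ c : ℂ, v = c • u := by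
  obtain ⟨c, hc⟩ := exists_dotProduct_eq_one hu
  refine ⟨c ⬝ᵥ v, ?_⟩
  rw [cross_apply] at h
  have h0 := congrFun h 0
  have h1 := congrFun h 1
  have h2 := congrFun h 2
  simp only [Matrix.cons_val_zero, Matrix.cons_val_one, Matrix.cons_val, Pi.zero_apply] at h0 h1 h2
  simp only [dotProduct, Fin.sum_univ_three] at hc ⊢
  funext i
  fin_cases i
  · simp; linear_combination (-v 0) * hc - c 1 * h2 + c 2 * h1
  · simp; linear_combination (-v 1) * hc + c 0 * h2 - c 2 * h0
  · simp; linear_combination (-v 2) * hc - c 0 * h1 + c 1 * h0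

theorem dotProduct_eq_zero_of_cross_eq_zero (hu : u ≠ 0) (h : crossProduct u v = 0)
    (hx : x ⬝ᵥ u = 0) : x ⬝ᵥ v = 0 := by
  obtain ⟨c, rfl⟩ := exists_smul_of_cross_eq_zero hu h
  rw [dotProduct_smul, hx, smul_zero]

theorem exists_smul_cross (h : crossProduct u v ≠ 0) (hu : u ⬝ᵥ w = 0) (hv : v ⬝ᵥ w = 0) :
    ∃ c : ℂ, w = c • crossProduct u v := by
  apply exists_smul_of_cross_eq_zero h
  rw [cross_cross_eq_smul_sub_smul, hu, hv]; simp

/-- Supplies a direction in which a multiple of `b` can be moved off its line while staying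
orthogonal to `a`. For c · b = 1 the vector a × c works, since (a × c) × b = −a. -/
theorem exists_perp_not_parallel (ha : a ⬝ᵥ b = 0) (h0 : a ≠ 0) (hb : b ≠ 0) :
    ∃ z : Fin 3 → ℂ, a ⬝ᵥ z = 0 ∧ crossProduct z b ≠ 0 := by
  obtain ⟨c, hc⟩ := exists_dotProduct_eq_one hb
  refine ⟨crossProduct a c, dot_self_cross _ _, ?_⟩
  have : crossProduct (crossProduct a c) b = -a := by
    rw [cross_cross_eq_smul_sub_smul, ha, hc]; simp
  rw [this]
  simpa using h0

theorem exists_perp_dotProduct_eq_one (h : crossProduct z x ≠ 0) :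
    ∃ l : Fin 3 → ℂ, l ⬝ᵥ z = 0 ∧ l ⬝ᵥ x = 1 := by
  obtain ⟨c, hc⟩ := exists_dotProduct_eq_one h
  refine ⟨crossProduct c z, ?_, ?_⟩
  · rw [dotProduct_comm, dot_cross_self]
  · rw [dotProduct_comm, triple_product_permutation, hc]

theorem exists_perp_pair (a b : Fin 3 → ℂ) : ∃ z : Fin 3 → ℂ, z ≠ 0 ∧ a ⬝ᵥ z = 0 ∧ b ⬝ᵥ z = 0 := by
  obtain ⟨z, hz, h⟩ := Matrix.exists_mulVec_eq_zero_iff.2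
    (show (Matrix.of ![a, b, b]).det = 0 from Matrix.det_zero_of_row_eq (i := 1) (j := 2)
      (by decide) rfl)
  exact ⟨z, hz, congrFun h 0, congrFun h 1⟩

/-- A transvection and its contragredient preserve the pairing. -/
theorem transvection_dotProduct (hz : w ⬝ᵥ z = 0) (t : ℂ) :
    (x + (t * (w ⬝ᵥ x)) • z) ⬝ᵥ (y - (t * (z ⬝ᵥ y)) • w) = x ⬝ᵥ y := by
  simp only [dotProduct, Fin.sum_univ_three, Pi.add_apply, Pi.sub_apply, Pi.smul_apply,
    smul_eq_mul] at *
  linear_combination (-t ^ 2 * (w 0 * x 0 + w 1 * x 1 + w 2 * x 2) *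
    (z 0 * y 0 + z 1 * y 1 + z 2 * y 2)) * hz

end Vectors

/-! ### Orthogonal realizations of graphs -/

section Realizations

variable {V : Type*} {G : SimpleGraph V} {S : Set V}

/-- The assignments of vectors to the vertices of a graph for which adjacent vertices are
orthogonal, and whose support is `S`. -/
def realizations (G : SimpleGraph V) (S : Set V) : Set (Config V) :=
  {f | (∀ v, f v ≠ 0 ↔ v ∈ S) ∧ ∀ u v, G.Adj u v → f u ⬝ᵥ f v = 0}

open Classical in
/-- The configuration `f` with its vector at `w` replaced by `z`. -/
noncomputable def replaceAt (f : Config V) (w : V) (z : Fin 3 → ℂ) : Config V :=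
  fun v => if v = w then z else f v

theorem replaceAt_self (f : Config V) (w : V) (z : Fin 3 → ℂ) : replaceAt f w z w = z := by
  simp [replaceAt]

theorem replaceAt_of_ne (f : Config V) {w v : V} (h : v ≠ w) (z : Fin 3 → ℂ) :
    replaceAt f w z v = f v := by
  simp [replaceAt, h]

theorem replaceAt_replaceAt (f : Config V) (w : V) (y z : Fin 3 → ℂ) :
    replaceAt (replaceAt f w y) w z = replaceAt f w z := by
  funext v
  by_cases h : v = w
  · subst h; simp [replaceAt_self]
  · simp [replaceAt_of_ne _ h]

theorem replaceAt_eq_self (f : Config V) (w : V) : replaceAt f w (f w) = f := by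
  funext v
  by_cases h : v = w
  · subst h; simp [replaceAt_self]
  · simp [replaceAt_of_ne _ h]

theorem isPoly_dotProduct {F F' : Config V → Fin 3 → ℂ} (hF : ∀ i, IsPoly fun f => F f i)
    (hF' : ∀ i, IsPoly fun f => F' f i) : IsPoly fun f => F f ⬝ᵥ F' f :=
  IsPoly.sum _ fun i _ => (hF i).mul (hF' i)

theorem isPoly_cross {F F' : Config V → Fin 3 → ℂ} (hF : ∀ i, IsPoly fun f => F f i)
    (hF' : ∀ i, IsPoly fun f => F' f i) (i : Fin 3) :
    IsPoly fun f => crossProduct (F f) (F' f) i := by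
  simp only [cross_apply]
  fin_cases i
  · exact ((hF 1).mul (hF' 2)).sub ((hF 2).mul (hF' 1))
  · exact ((hF 2).mul (hF' 0)).sub ((hF 0).mul (hF' 2))
  · exact ((hF 0).mul (hF' 1)).sub ((hF 1).mul (hF' 0))

theorem isOpen_ne_zero {F : Config V → Fin 3 → ℂ} (hF : ∀ i, IsPoly fun f => F f i) :
    IsOpen {f | F f ≠ 0} := by
  have : {f | F f ≠ 0} = ⋃ i, {f | F f i ≠ 0} := by
    ext f
    simp [funext_iff]
  rw [this]
  exact isOpen_iUnion fun i => (hF i).isOpen_ne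

theorem continuous_replaceAt (w : V) {F : Config V → Fin 3 → ℂ}
    (hF : ∀ i, IsPoly fun f => F f i) : Continuous fun f : Config V => replaceAt f w (F f) := by
  refine continuous_of_isPoly fun v i => ?_
  by_cases h : v = w
  · subst h; simpa [replaceAt_self] using hF i
  · simpa [replaceAt_of_ne _ h] using IsPoly.coord v i

/-- A family over an irreducible base whose fibres are punctured linear spaces, with enough
sections, is irreducible. -/
theorem isPreirreducible_of_sections {X Y : Set (Config V)} (hY : IsPreirreducible Y) (w : V)
    (hsec : ∀ x ∈ X, ∃ F : Config V → Fin 3 → ℂ, (∀ i, IsPoly fun f => F f i) ∧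
      replaceAt x w 0 ∈ Y ∧ F (replaceAt x w 0) = x w ∧
      ∀ y ∈ Y, F y ≠ 0 → replaceAt y w (F y) ∈ X)
    (hlin : ∀ y ∈ Y, ∀ a b : Fin 3 → ℂ, ∀ t : ℂ, replaceAt y w a ∈ X → replaceAt y w b ∈ X →
      (1 - t) • a + t • b ≠ 0 → replaceAt y w ((1 - t) • a + t • b) ∈ X)
    (hne : ∀ x ∈ X, x w ≠ 0) : IsPreirreducible X := by
  rintro U₁ U₂ hU₁ hU₂ ⟨x₁, hx₁, hxU₁⟩ ⟨x₂, hx₂, hxU₂⟩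
  have hW : IsOpen {f : Config V | f w ≠ 0} := isOpen_ne_zero fun i => IsPoly.coord w i
  obtain ⟨F₁, hF₁, hb₁, hs₁, hm₁⟩ := hsec x₁ hx₁
  obtain ⟨F₂, hF₂, hb₂, hs₂, hm₂⟩ := hsec x₂ hx₂
  -- Both open sets are pulled back to the base along sections through the given points. At a common
  -- base point the two values lie in one fibre, and the line joining them meets both sets.
  -- Intersecting with the locus where the vector at `w` is nonzero avoids the puncture.
  have hO₁ := (hU₁.inter hW).preimage (continuous_replaceAt w hF₁)
  have hO₂ := (hU₂.inter hW).preimage (continuous_replaceAt w hF₂)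
  obtain ⟨y, hy, ⟨hy1, hy1'⟩, ⟨hy2, hy2'⟩⟩ := hY _ _ hO₁ hO₂
    ⟨_, hb₁, by
      simp only [mem_preimage, hs₁, replaceAt_replaceAt, replaceAt_eq_self]
      exact ⟨hxU₁, hne _ hx₁⟩⟩
    ⟨_, hb₂, by
      simp only [mem_preimage, hs₂, replaceAt_replaceAt, replaceAt_eq_self]
      exact ⟨hxU₂, hne _ hx₂⟩⟩
  simp only [mem_ofPred_eq, replaceAt_self] at hy1' hy2'
  obtain ⟨t, ⟨ht1, htW⟩, ht2⟩ := exists_linePoint_mem (hU₁.inter hW) hU₂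
    (a := replaceAt y w (F₁ y)) (b := replaceAt y w (F₂ y))
    ⟨hy1, by simpa [replaceAt_self] using hy1'⟩ hy2
  have e : linePoint (replaceAt y w (F₁ y)) (replaceAt y w (F₂ y)) t =
      replaceAt y w ((1 - t) • F₁ y + t • F₂ y) := by
    funext v
    by_cases h : v = w
    · subst h; simp [replaceAt_self, linePoint]
    · simp only [linePoint, replaceAt_of_ne _ h]
      rw [← add_smul]; simp
  rw [e] at ht1 htW ht2
  refine ⟨_, hlin y hy _ _ t (hm₁ y hy hy1') (hm₂ y hy hy2') ?_, ht1, ht2⟩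
  simpa [replaceAt_self] using htW

theorem realizations_empty : IsPreirreducible (realizations G ∅) := by
  apply Set.Subsingleton.isPreirreducible
  rintro f ⟨hf, -⟩ g ⟨hg, -⟩
  funext v
  have h1 := hf v
  have h2 := hg v
  simp only [ne_eq, mem_empty_iff_false, iff_false, not_not] at h1 h2
  rw [h1, h2]

theorem replaceAt_zero_mem_realizations {w : V} (hw : w ∉ S) {f : Config V}
    (hf : f ∈ realizations G (insert w S)) : replaceAt f w 0 ∈ realizations G S := by
  refine ⟨fun v => ?_, fun u v huv => ?_⟩
  · by_cases h : v = w
    · subst h; simp [replaceAt_self, hw]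
    · rw [replaceAt_of_ne _ h, hf.1]; simp [h]
  · by_cases h : u = w
    · subst h; simp [replaceAt_self]
    by_cases h' : v = w
    · subst h'; simp [replaceAt_self]
    rw [replaceAt_of_ne _ h, replaceAt_of_ne _ h']
    exact hf.2 u v huv

theorem replaceAt_mem_realizations {w : V} {f : Config V} {z : Fin 3 → ℂ}
    (hf : f ∈ realizations G S) (hz : z ≠ 0) (h : ∀ u ∈ S, G.Adj w u → f u ⬝ᵥ z = 0) :
    replaceAt f w z ∈ realizations G (insert w S) := by
  have key : ∀ u, G.Adj w u → f u ⬝ᵥ z = 0 := by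
    intro u hu
    by_cases huS : u ∈ S
    · exact h u huS hu
    · have : f u = 0 := by
        by_contra hc
        exact huS ((hf.1 u).1 hc)
      simp [this]
  refine ⟨fun v => ?_, fun u v huv => ?_⟩
  · by_cases hv : v = w
    · subst hv; simp [replaceAt_self, hz]
    · rw [replaceAt_of_ne _ hv, hf.1]; simp [hv]
  · by_cases hu : u = w
    · subst hu
      rw [replaceAt_self, replaceAt_of_ne _ huv.ne', dotProduct_comm]
      exact key v huv
    by_cases hv : v = w
    · subst hv
      rw [replaceAt_self, replaceAt_of_ne _ hu]
      exact key u huv.symm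
    rw [replaceAt_of_ne _ hu, replaceAt_of_ne _ hv]
    exact hf.2 u v huv

theorem dotProduct_eq_zero_of_replaceAt_mem {w u : V} {T : Set V} {f : Config V}
    {z : Fin 3 → ℂ} (hf : replaceAt f w z ∈ realizations G T) (hu : G.Adj w u) :
    f u ⬝ᵥ z = 0 := by
  have := hf.2 _ _ hu.symm
  rwa [replaceAt_self, replaceAt_of_ne _ hu.ne'] at this

/-- The fibre is the punctured plane orthogonal to the vector at the unique neighbour `u`, or all
nonzero vectors if there is none. A section through `x` is f ↦ (c · f_u) x_w − (x_w · f_u) c with c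
· x_u = 1: it is identically orthogonal to f_u and equals x_w at `x`. -/
theorem isPreirreducible_insert {w : V} (hS : IsPreirreducible (realizations G S)) (hw : w ∉ S)
    (hN : ∀ u ∈ S, ∀ u' ∈ S, G.Adj w u → G.Adj w u' → u = u') :
    IsPreirreducible (realizations G (insert w S)) := by
  have hne : ∀ x ∈ realizations G (insert w S), x w ≠ 0 := fun x hx => (hx.1 w).2 (by simp)
  refine isPreirreducible_of_sections hS w (fun x hx => ?_) (fun y hy a b t ha hb h0 => ?_) hne
  · by_cases hu : ∃ u ∈ S, G.Adj w u
    · obtain ⟨u, huS, huw⟩ := hu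
      obtain ⟨c, hc⟩ := exists_dotProduct_eq_one ((hx.1 u).2 (by simp [huS]))
      refine ⟨fun f => (c ⬝ᵥ f u) • x w - (x w ⬝ᵥ f u) • c, fun i => ?_,
        replaceAt_zero_mem_realizations hw hx, ?_, fun y hy hy0 => ?_⟩
      · have h1 : ∀ d : Fin 3 → ℂ, IsPoly fun f : Config V => d ⬝ᵥ f u := fun d =>
          isPoly_dotProduct (fun i => IsPoly.const _) (fun i => IsPoly.coord u i)
        exact ((h1 c).mul (IsPoly.const _)).sub ((h1 (x w)).mul (IsPoly.const _))
      · beta_reduce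
        rw [replaceAt_of_ne _ huw.ne', hc, hx.2 w u huw]; simp
      · refine replaceAt_mem_realizations hy hy0 fun u' hu' hadj => ?_
        obtain rfl := hN u huS u' hu' huw hadj
        simp only [dotProduct_sub, dotProduct_smul, smul_eq_mul]
        rw [dotProduct_comm (y u) (x w), dotProduct_comm (y u) c]; ring
    · push Not at hu
      refine ⟨fun _ => x w, fun i => IsPoly.const _, replaceAt_zero_mem_realizations hw hx, rfl,
        fun y hy hy0 => replaceAt_mem_realizations hy hy0 fun u hu' hadj => ?_⟩
      exact absurd hadj (hu u hu')
  · refine replaceAt_mem_realizations hy h0 fun u _ hadj => ?_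
    rw [dotProduct_add, dotProduct_smul, dotProduct_smul,
      dotProduct_eq_zero_of_replaceAt_mem ha hadj, dotProduct_eq_zero_of_replaceAt_mem hb hadj]
    simp

theorem IsPreirreducible.inter_isOpen {T : Type*} [TopologicalSpace T] {X U : Set T}
    (hX : IsPreirreducible X) (hU : IsOpen U) : IsPreirreducible (X ∩ U) := by
  rintro U₁ U₂ h₁ h₂ ⟨x, ⟨hx, hxU⟩, hx1⟩ ⟨y, ⟨hy, hyU⟩, hy2⟩
  obtain ⟨z, hz, ⟨hzU, hz1⟩, -, hz2⟩ := hX _ _ (hU.inter h₁) (hU.inter h₂)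
    ⟨x, hx, hxU, hx1⟩ ⟨y, hy, hyU, hy2⟩
  exact ⟨z, ⟨hz, hzU⟩, hz1, hz2⟩

/-- Where the vectors at the two neighbours are not parallel, the fibre is the punctured line
spanned by their cross product, and constant multiples of the cross product are sections. -/
theorem isPreirreducible_insert_of_cross {w u v : V} (hS : IsPreirreducible (realizations G S))
    (hw : w ∉ S) (hu : u ∈ S) (hv : v ∈ S) (hwu : G.Adj w u) (hwv : G.Adj w v)
    (hN : ∀ x ∈ S, G.Adj w x → x = u ∨ x = v) :
    IsPreirreducible (realizations G (insert w S) ∩ {f | crossProduct (f u) (f v) ≠ 0}) := by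
  have hcr : ∀ i, IsPoly fun f : Config V => crossProduct (f u) (f v) i :=
    isPoly_cross (fun i => IsPoly.coord u i) (fun i => IsPoly.coord v i)
  have hY := IsPreirreducible.inter_isOpen hS (isOpen_ne_zero hcr)
  have hne : ∀ x ∈ realizations G (insert w S), x w ≠ 0 := fun x hx => (hx.1 w).2 (by simp)
  have hop : ∀ (y : Config V) (z : Fin 3 → ℂ), crossProduct (y u) (y v) ≠ 0 →
      crossProduct (replaceAt y w z u) (replaceAt y w z v) ≠ 0 := by
    intro y z hy
    rwa [replaceAt_of_ne _ hwu.ne', replaceAt_of_ne _ hwv.ne']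
  refine isPreirreducible_of_sections hY w (fun x hx => ?_)
    (fun y hy a b t ha hb h0 => ⟨?_, hop _ _ hy.2⟩) (fun x hx => hne x hx.1)
  · obtain ⟨k, hk⟩ := exists_smul_cross hx.2 (hx.1.2 _ _ hwu.symm) (hx.1.2 _ _ hwv.symm)
    refine ⟨fun f => k • crossProduct (f u) (f v), fun i => (IsPoly.const k).mul (hcr i),
      ⟨replaceAt_zero_mem_realizations hw hx.1, hop _ _ hx.2⟩, ?_, fun y hy hy0 =>
      ⟨replaceAt_mem_realizations hy.1 hy0 fun x' hx' hadj => ?_, hop _ _ hy.2⟩⟩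
    · beta_reduce
      rw [replaceAt_of_ne _ hwu.ne', replaceAt_of_ne _ hwv.ne', ← hk]
    · rw [dotProduct_smul]
      rcases hN x' hx' hadj with rfl | rfl
      · rw [dot_self_cross]; simp
      · rw [dot_cross_self]; simp
  · refine replaceAt_mem_realizations hy.1 h0 fun u _ hadj => ?_
    rw [dotProduct_add, dotProduct_smul, dotProduct_smul,
      dotProduct_eq_zero_of_replaceAt_mem ha.1 hadj, dotProduct_eq_zero_of_replaceAt_mem hb.1 hadj]
    simp

end Realizations

/-! ### Attaching a cycle at a vertex -/

section PathDeformations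

variable {x : ℕ → Fin 3 → ℂ} {m : ℕ}

/-- The portion `k + 2, …, m` of the cycle is moved by a transvection along `z` on even indices and
by its contragredient on odd ones, so orthogonality within it survives. As `m` is even, x_m becomes
x_m + t z, still orthogonal to x_{m+1} but no longer parallel to x_0. The vector at `k + 1` absorbs
the mismatch with the fixed portion: it was a multiple of x_k × x_{k+2} and remains one with the
moved x_{k+2}. -/
theorem exists_deformation_of_cross_ne (hm : Even m) {k : ℕ} (hk : k + 2 ≤ m)
    (h0 : ∀ i ≤ m + 1, x i ≠ 0) (hx : ∀ i ≤ m, x i ⬝ᵥ x (i + 1) = 0)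
    (hc : x (m + 1) ⬝ᵥ x 0 = 0) (hne : crossProduct (x k) (x (k + 2)) ≠ 0)
    (hpar : crossProduct (x m) (x 0) = 0) :
    ∃ Φ : ℂ → ℕ → Fin 3 → ℂ, (∀ i, Continuous fun t => Φ t i) ∧ Φ 0 = x ∧
      ∀ t, Φ t 0 = x 0 ∧ Φ t (m + 1) = x (m + 1) ∧ (∀ i ≤ m, Φ t i ⬝ᵥ Φ t (i + 1) = 0) ∧
        (t ≠ 0 → crossProduct (Φ t m) (Φ t 0) ≠ 0) := by
  obtain ⟨z, hz, hz0⟩ := exists_perp_not_parallel hc (h0 _ le_rfl) (h0 0 (by omega))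
  have hzm : crossProduct z (x m) ≠ 0 := by
    intro h
    obtain ⟨c, hc⟩ := exists_smul_of_cross_eq_zero (h0 m (by omega)) hpar
    rw [hc, map_smul, h, smul_zero] at hz0
    exact hz0 rfl
  obtain ⟨l, hl, hl1⟩ := exists_perp_dotProduct_eq_one hzm
  obtain ⟨c, hcr⟩ := exists_smul_cross hne (hx k (by omega))
    (by rw [dotProduct_comm]; exact hx (k + 1) (by omega))
  let Ψ : ℂ → ℕ → Fin 3 → ℂ := fun t i =>
    if Even i then x i + (t * (l ⬝ᵥ x i)) • z else x i - (t * (z ⬝ᵥ x i)) • l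
  let Φ : ℂ → ℕ → Fin 3 → ℂ := fun t i =>
    if i ≤ k ∨ m < i then x i else
      if i = k + 1 then c • crossProduct (x k) (Ψ t (k + 2)) else Ψ t i
  have hΨ0 : ∀ i, Ψ 0 i = x i := fun i => by simp [Ψ]
  have hΨc : ∀ i, Continuous fun t => Ψ t i := by
    intro i
    by_cases hi : Even i
    · simp only [Ψ, hi, if_true]; fun_prop
    · simp only [Ψ, hi, if_false]; fun_prop
  have hΨ : ∀ t i, x i ⬝ᵥ x (i + 1) = 0 → Ψ t i ⬝ᵥ Ψ t (i + 1) = 0 := by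
    intro t i hi
    by_cases he : Even i
    · have he' : ¬ Even (i + 1) := by simpa [Nat.even_add_one] using he
      simp only [Ψ, he, he', if_true, if_false]
      rw [transvection_dotProduct hl, hi]
    · have he' : Even (i + 1) := by simpa [Nat.even_add_one] using he
      simp only [Ψ, he, he', if_true, if_false]
      rw [dotProduct_comm, transvection_dotProduct hl, dotProduct_comm, hi]
  have hlow : ∀ t i, i ≤ k → Φ t i = x i := fun t i hi => by simp [Φ, hi]
  have hlast : ∀ t, Φ t (m + 1) = x (m + 1) := fun t => by simp [Φ]
  have hmid : ∀ t, Φ t (k + 1) = c • crossProduct (x k) (Ψ t (k + 2)) := fun t => by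
    simp [Φ, show ¬ m < k + 1 by omega]
  have hhigh : ∀ t i, k + 2 ≤ i → i ≤ m → Φ t i = Ψ t i := fun t i h1 h2 => by
    simp [Φ, show ¬ (i ≤ k ∨ m < i) by omega, show i ≠ k + 1 by omega]
  have hΨm : ∀ t, Ψ t m = x m + t • z := fun t => by simp [Ψ, hm, hl1]
  refine ⟨Φ, fun i => ?_, ?_, fun t => ⟨hlow t 0 (by omega), hlast t, fun i hi => ?_, fun ht => ?_⟩⟩
  · by_cases h1 : i ≤ k ∨ m < i
    · simp only [Φ, h1, if_true]; fun_prop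
    · by_cases h2 : i = k + 1
      · subst h2
        simp only [hmid]
        refine Continuous.const_smul ?_ c
        exact (LinearMap.continuous_of_finiteDimensional (crossProduct (x k))).comp (hΨc _)
      · simp only [Φ, h1, h2, if_false]
        exact hΨc i
  · funext i
    by_cases h1 : i ≤ k ∨ m < i
    · simp only [Φ, h1, if_true]
    · by_cases h2 : i = k + 1
      · subst h2
        rw [hmid, hΨ0, ← hcr]
      · simp only [Φ, h1, h2, if_false]
        exact hΨ0 i
  · rcases lt_trichotomy i k with h | h | h
    · rw [hlow t i h.le, hlow t (i + 1) (by omega), hx i hi]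
    · subst h
      rw [hlow t i le_rfl, hmid, dotProduct_smul, dot_self_cross, smul_zero]
    · rcases eq_or_lt_of_le (show k + 1 ≤ i from h) with rfl | h'
      · rw [hmid, hhigh t (k + 2) le_rfl hk, dotProduct_comm, dotProduct_smul, dot_cross_self,
          smul_zero]
      · rw [hhigh t i h' hi]
        rcases eq_or_lt_of_le hi with rfl | hi'
        · rw [hlast, hΨm, add_dotProduct, hx i hi, smul_dotProduct, dotProduct_comm, hz]
          simp
        · rw [hhigh t (i + 1) (by omega) hi']
          exact hΨ t i (hx i hi)
  · rw [hhigh t m hk le_rfl, hlow t 0 (by omega), hΨm, map_add, LinearMap.add_apply, hpar, zero_add,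
      map_smul, LinearMap.smul_apply]
    exact smul_ne_zero ht hz0

/-- As x_1 and x_3 are parallel, x_2 may move freely in the plane orthogonal to both, and so leave
the line of x_0. -/
theorem exists_deformation_of_cross_eq (hm : 4 ≤ m)
    (h0 : ∀ i ≤ m + 1, x i ≠ 0) (hx : ∀ i ≤ m, x i ⬝ᵥ x (i + 1) = 0)
    (h02 : crossProduct (x 0) (x 2) = 0) (h13 : crossProduct (x 1) (x 3) = 0) :
    ∃ Φ : ℂ → ℕ → Fin 3 → ℂ, (∀ i, Continuous fun t => Φ t i) ∧ Φ 0 = x ∧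
      ∀ t, Φ t 0 = x 0 ∧ Φ t (m + 1) = x (m + 1) ∧ (∀ i ≤ m, Φ t i ⬝ᵥ Φ t (i + 1) = 0) ∧
        (t ≠ 0 → crossProduct (Φ t 0) (Φ t 2) ≠ 0) := by
  obtain ⟨z, hz, hz0⟩ := exists_perp_not_parallel
    (show x 1 ⬝ᵥ x 0 = 0 by rw [dotProduct_comm]; exact hx 0 (by omega))
    (h0 1 (by omega)) (h0 0 (by omega))
  have hz3 : x 3 ⬝ᵥ z = 0 := by
    rw [dotProduct_comm] at hz ⊢
    exact dotProduct_eq_zero_of_cross_eq_zero (h0 1 (by omega)) h13 hz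
  let Φ : ℂ → ℕ → Fin 3 → ℂ := fun t i => if i = 2 then x 2 + t • z else x i
  have h2 : ∀ t, Φ t 2 = x 2 + t • z := fun t => by simp [Φ]
  have hn : ∀ t i, i ≠ 2 → Φ t i = x i := fun t i hi => by simp [Φ, hi]
  refine ⟨Φ, fun i => ?_, ?_, fun t => ⟨hn t 0 (by omega), hn t _ (by omega), fun i hi => ?_,
    fun ht => ?_⟩⟩
  · by_cases hi : i = 2
    · subst hi; simp only [h2]; fun_prop
    · simp only [hn _ i hi]; fun_prop
  · funext i
    by_cases hi : i = 2
    · subst hi; rw [h2]; simp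
    · rw [hn _ i hi]
  · by_cases h1 : i = 1
    · subst h1
      rw [hn t 1 (by omega), h2, dotProduct_add, hx 1 hi, dotProduct_smul, hz]; simp
    by_cases h3 : i = 2
    · subst h3
      rw [hn t 3 (by omega), h2, add_dotProduct, hx 2 hi, smul_dotProduct, dotProduct_comm z, hz3]
      simp
    rw [hn t i h3, hn t (i + 1) (by omega), hx i hi]
  · rw [hn t 0 (by omega), h2, map_add, h02, zero_add, map_smul]
    refine smul_ne_zero ht fun h => hz0 ?_
    rw [← cross_anticomm, h, neg_zero]

end PathDeformations

theorem IsPreirreducible.of_subset_closure {T : Type*} [TopologicalSpace T] {A X : Set T}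
    (hA : IsPreirreducible A) (h₁ : A ⊆ X) (h₂ : X ⊆ closure A) : IsPreirreducible X := by
  rw [← isPreirreducible_iff_closure] at hA ⊢
  rwa [(closure_minimal h₂ isClosed_closure).antisymm (closure_mono h₁)]

section Ears

variable {V : Type*} {G : SimpleGraph V} {S : Set V} {w : ℕ → V} {m : ℕ}

/-- The vertices `w 1, …, w (m + 1)` lie outside `S` and form together with the vertex `w 0` of `S`
an induced cycle, which is attached to `S` at `w 0` only. -/
structure IsEar (G : SimpleGraph V) (S : Set V) (w : ℕ → V) (m : ℕ) : Prop where
  start_mem : w 0 ∈ S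
  notMem : ∀ i, 1 ≤ i → i ≤ m + 1 → w i ∉ S
  inj : ∀ i j, i ≤ m + 1 → j ≤ m + 1 → w i = w j → i = j
  adj : ∀ i ≤ m, G.Adj (w i) (w (i + 1))
  adj_last : G.Adj (w (m + 1)) (w 0)
  attach : ∀ i, 1 ≤ i → i ≤ m + 1 → ∀ u ∈ S, G.Adj (w i) u → u = w 0 ∧ (i = 1 ∨ i = m + 1)
  chord : ∀ i j, 1 ≤ i → i < j → j ≤ m + 1 → G.Adj (w i) (w j) → j = i + 1

theorem union_image_Icc_succ (S : Set V) (w : ℕ → V) (k : ℕ) :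
    S ∪ w '' Icc 1 (k + 1) = insert (w (k + 1)) (S ∪ w '' Icc 1 k) := by
  have : Icc 1 (k + 1) = insert (k + 1) (Icc 1 k) := by
    ext i; simp only [mem_Icc, mem_insert_iff]; omega
  rw [this, image_insert_eq, union_insert]

theorem IsEar.notMem_union (h : IsEar G S w m) {k : ℕ} (hk : k ≤ m) :
    w (k + 1) ∉ S ∪ w '' Icc 1 k := by
  rintro (h1 | ⟨i, ⟨hi1, hi2⟩, hi⟩)
  · exact h.notMem (k + 1) (by omega) (by omega) h1
  · have := h.inj i (k + 1) (by omega) (by omega) hi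
    omega

theorem IsEar.eq_of_adj (h : IsEar G S w m) {k : ℕ} (hk : k ≤ m) {u : V}
    (hu : u ∈ S ∪ w '' Icc 1 k) (hadj : G.Adj (w (k + 1)) u) : u = w k ∨ (k = m ∧ u = w 0) := by
  rcases hu with hu | ⟨i, ⟨hi1, hi2⟩, rfl⟩
  · obtain ⟨rfl, h1 | h1⟩ := h.attach _ (by omega) (by omega) u hu hadj
    · obtain rfl : k = 0 := by omega
      exact Or.inl rfl
    · exact Or.inr ⟨by omega, rfl⟩
  · have := h.chord i (k + 1) hi1 (by omega) (by omega) hadj.symm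
    obtain rfl : k = i := by omega
    exact Or.inl rfl

theorem IsEar.eq_of_adj_interior (h : IsEar G S w m) {i : ℕ} (hi1 : 1 ≤ i) (hi : i ≤ m) {u : V}
    (hu : u ∈ S ∪ w '' Icc 1 (m + 1)) (hadj : G.Adj (w i) u) : u = w (i - 1) ∨ u = w (i + 1) := by
  rcases hu with hu | ⟨j, ⟨hj1, hj2⟩, rfl⟩
  · obtain ⟨rfl, h1 | h1⟩ := h.attach _ hi1 (by omega) u hu hadj
    · subst h1; exact Or.inl rfl
    · omega
  · rcases lt_trichotomy i j with hij | rfl | hij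
    · rw [h.chord i j hi1 hij hj2 hadj]; exact Or.inr rfl
    · exact absurd rfl hadj.ne
    · rw [h.chord j i hj1 hij (by omega) hadj.symm]; exact Or.inl rfl

/-- Before the cycle closes, each new vertex has only its predecessor as an earlier neighbour. -/
theorem IsEar.isPreirreducible_path (h : IsEar G S w m) (hS : IsPreirreducible (realizations G S))
    {k : ℕ} (hk : k ≤ m) : IsPreirreducible (realizations G (S ∪ w '' Icc 1 k)) := by
  induction k with
  | zero => simpa using hS
  | succ k ih =>
    rw [union_image_Icc_succ]
    refine isPreirreducible_insert (ih (by omega)) (h.notMem_union (by omega))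
      fun u hu u' hu' h1 h2 => ?_
    rcases h.eq_of_adj (by omega) hu h1 with rfl | h1
    · rcases h.eq_of_adj (by omega) hu' h2 with rfl | h2
      · rfl
      · omega
    · omega

open Classical in
/-- The configuration `f` with the vectors at `w 1, …, w m` replaced by those of `φ`. -/
noncomputable def replacePath (f : Config V) (w : ℕ → V) (m : ℕ) (φ : ℕ → Fin 3 → ℂ) : Config V :=
  fun v => if h : ∃ i, 1 ≤ i ∧ i ≤ m ∧ w i = v then φ h.choose else f v

theorem IsEar.replacePath_apply (h : IsEar G S w m) {f : Config V} {φ : ℕ → Fin 3 → ℂ}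
    (h0 : φ 0 = f (w 0)) (hm : φ (m + 1) = f (w (m + 1))) {i : ℕ} (hi : i ≤ m + 1) :
    replacePath f w m φ (w i) = φ i := by
  by_cases hex : ∃ j, 1 ≤ j ∧ j ≤ m ∧ w j = w i
  · have hs := hex.choose_spec
    rw [replacePath, dif_pos hex, h.inj _ i (by omega) hi hs.2.2]
  · rw [replacePath, dif_neg hex]
    push Not at hex
    rcases Nat.eq_zero_or_pos i with rfl | hpos
    · exact h0.symm
    · rcases eq_or_lt_of_le hi with rfl | hlt
      · exact hm.symm
      · exact absurd rfl (hex i hpos (by omega))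

theorem replacePath_of_ne {f : Config V} {φ : ℕ → Fin 3 → ℂ} {v : V}
    (hv : ∀ i, 1 ≤ i → i ≤ m → w i ≠ v) : replacePath f w m φ v = f v := by
  rw [replacePath, dif_neg]
  rintro ⟨i, h1, h2, h3⟩
  exact hv i h1 h2 h3

theorem IsEar.replacePath_mem (h : IsEar G S w m) {f : Config V} {φ : ℕ → Fin 3 → ℂ}
    (hf : f ∈ realizations G (S ∪ w '' Icc 1 (m + 1)))
    (h0 : φ 0 = f (w 0)) (hm : φ (m + 1) = f (w (m + 1)))
    (hne : ∀ i, 1 ≤ i → i ≤ m → φ i ≠ 0) (horth : ∀ i ≤ m, φ i ⬝ᵥ φ (i + 1) = 0) :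
    replacePath f w m φ ∈ realizations G (S ∪ w '' Icc 1 (m + 1)) := by
  have key : ∀ i, 1 ≤ i → i ≤ m → ∀ v, G.Adj (w i) v →
      replacePath f w m φ (w i) ⬝ᵥ replacePath f w m φ v = 0 := by
    intro i hi1 hi2 v hadj
    by_cases hv : v ∈ S ∪ w '' Icc 1 (m + 1)
    · rcases h.eq_of_adj_interior hi1 hi2 hv hadj with rfl | rfl
      · rw [h.replacePath_apply h0 hm (by omega), h.replacePath_apply h0 hm (by omega),
          dotProduct_comm]
        have := horth (i - 1) (by omega)
        rwa [Nat.sub_add_cancel hi1] at this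
      · rw [h.replacePath_apply h0 hm (by omega), h.replacePath_apply h0 hm (by omega)]
        exact horth i hi2
    · have hfv : f v = 0 := by
        by_contra hc
        exact hv ((hf.1 v).1 hc)
      have : replacePath f w m φ v = f v := replacePath_of_ne fun j hj1 hj2 hj =>
        hv (Or.inr ⟨j, ⟨hj1, by omega⟩, hj⟩)
      rw [this, hfv, dotProduct_zero]
  refine ⟨fun v => ?_, fun u v huv => ?_⟩
  · by_cases hv : ∃ i, 1 ≤ i ∧ i ≤ m ∧ w i = v
    · obtain ⟨i, hi1, hi2, rfl⟩ := hv
      rw [h.replacePath_apply h0 hm (by omega)]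
      exact iff_of_true (hne i hi1 hi2) (Or.inr ⟨i, ⟨hi1, by omega⟩, rfl⟩)
    · push Not at hv
      rw [replacePath_of_ne hv, hf.1]
  · by_cases hu : ∃ i, 1 ≤ i ∧ i ≤ m ∧ w i = u
    · obtain ⟨i, hi1, hi2, rfl⟩ := hu
      exact key i hi1 hi2 v huv
    by_cases hv : ∃ i, 1 ≤ i ∧ i ≤ m ∧ w i = v
    · obtain ⟨i, hi1, hi2, rfl⟩ := hv
      rw [dotProduct_comm]
      exact key i hi1 hi2 u huv.symm
    push Not at hu hv
    rw [replacePath_of_ne hu, replacePath_of_ne hv]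
    exact hf.2 u v huv

/-- Since `w 0` and `w (m + 1)` keep their vectors and the interior vertices of the path have no
other neighbours in the support, the deformation can be spliced into `f`. For small `t` the moved
vectors stay nonzero, by continuity. -/
theorem IsEar.mem_closure_of_deformation (h : IsEar G S w m) {f : Config V}
    (hf : f ∈ realizations G (S ∪ w '' Icc 1 (m + 1))) {P : Set (Config V)}
    (Φ : ℂ → ℕ → Fin 3 → ℂ) (hc : ∀ i, Continuous fun t => Φ t i)
    (hΦ0 : Φ 0 = fun i => f (w i))
    (hΦ : ∀ t, Φ t 0 = f (w 0) ∧ Φ t (m + 1) = f (w (m + 1)) ∧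
      ∀ i ≤ m, Φ t i ⬝ᵥ Φ t (i + 1) = 0)
    (hP : ∀ t ≠ 0, ∀ g : Config V, (∀ i ≤ m + 1, g (w i) = Φ t i) → g ∈ P) :
    f ∈ closure (realizations G (S ∪ w '' Icc 1 (m + 1)) ∩ P) := by
  let γ : ℂ → V → Fin 3 → ℂ := fun t => replacePath f w m (Φ t)
  have hcont : Continuous γ := by
    refine continuous_pi fun v => ?_
    by_cases hv : ∃ i, 1 ≤ i ∧ i ≤ m ∧ w i = v
    · simp only [γ, replacePath, hv, dif_pos]
      exact hc _
    · simp only [γ, replacePath, hv, dif_neg, not_false_iff]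
      fun_prop
  have h0 : replacePath f w m (Φ 0) = f := by
    funext v
    by_cases hv : ∃ i, 1 ≤ i ∧ i ≤ m ∧ w i = v
    · obtain ⟨i, hi1, hi2, rfl⟩ := hv
      rw [h.replacePath_apply (hΦ 0).1 (hΦ 0).2.1 (by omega), hΦ0]
    · push Not at hv
      rw [replacePath_of_ne hv]
  have hev : ∀ᶠ t in 𝓝[≠] (0 : ℂ), ∀ i ∈ Icc 1 m, Φ t i ≠ 0 := by
    refine Filter.Eventually.filter_mono nhdsWithin_le_nhds
      ((eventually_all_finite (finite_Icc 1 m)).2 fun i hi => ?_)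
    refine (hc i).continuousAt.eventually_ne ?_
    rw [hΦ0]
    exact (hf.1 _).2 (Or.inr ⟨i, ⟨hi.1, by have := hi.2; omega⟩, rfl⟩)
  have := mem_closure_of_curve (A := realizations G (S ∪ w '' Icc 1 (m + 1)) ∩ P)
    γ hcont (by
      filter_upwards [hev, self_mem_nhdsWithin] with t ht ht0
      exact ⟨h.replacePath_mem hf (hΦ t).1 (hΦ t).2.1 (fun i h1 h2 => ht i ⟨h1, h2⟩) (hΦ t).2.2,
        hP t ht0 _ fun i hi => h.replacePath_apply (hΦ t).1 (hΦ t).2.1 hi⟩)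
  rwa [show γ 0 = f from h0] at this

/-- If x_0, x_2 or x_1, x_3 are not parallel, the transvection deformation applies with `k = 0` or
`k = 1`; the latter needs `3 ≤ m`. If both pairs are parallel, `f` is first approximated by
realizations with x_0, x_2 not parallel. A cycle of length four would fail: orthogonality forces one
of the two pairs to be parallel. -/
theorem IsEar.subset_closure (h : IsEar G S w m) (hm : Even m) (hm4 : 4 ≤ m) :
    realizations G (S ∪ w '' Icc 1 (m + 1)) ⊆
      closure (realizations G (S ∪ w '' Icc 1 (m + 1)) ∩
        {f | crossProduct (f (w m)) (f (w 0)) ≠ 0}) := by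
  set R := realizations G (S ∪ w '' Icc 1 (m + 1)) with hR
  have hne : ∀ f ∈ R, ∀ i ≤ m + 1, f (w i) ≠ 0 := by
    intro f hf i hi
    rw [hf.1]
    rcases Nat.eq_zero_or_pos i with rfl | hpos
    · exact Or.inl h.start_mem
    · exact Or.inr ⟨i, ⟨hpos, hi⟩, rfl⟩
  have horth : ∀ f ∈ R, ∀ i ≤ m, f (w i) ⬝ᵥ f (w (i + 1)) = 0 :=
    fun f hf i hi => hf.2 _ _ (h.adj i hi)
  have step : ∀ f ∈ R, ∀ k, k + 2 ≤ m → crossProduct (f (w k)) (f (w (k + 2))) ≠ 0 →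
      f ∈ closure (R ∩ {f | crossProduct (f (w m)) (f (w 0)) ≠ 0}) := by
    intro f hf k hk hcr
    by_cases hpar : crossProduct (f (w m)) (f (w 0)) = 0
    · obtain ⟨Φ, hc, h0, hΦ⟩ := exists_deformation_of_cross_ne (x := fun i => f (w i)) hm hk
        (hne f hf) (horth f hf) (hf.2 _ _ h.adj_last) hcr hpar
      refine h.mem_closure_of_deformation hf Φ hc h0
        (fun t => ⟨(hΦ t).1, (hΦ t).2.1, (hΦ t).2.2.1⟩) fun t ht g hg => ?_
      rw [mem_ofPred_eq, hg _ (by omega), hg _ (by omega)]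
      exact (hΦ t).2.2.2 ht
    · exact _root_.subset_closure ⟨hf, hpar⟩
  intro f hf
  by_cases h02 : crossProduct (f (w 0)) (f (w 2)) = 0
  swap
  · exact step f hf 0 (by omega) h02
  by_cases h13 : crossProduct (f (w 1)) (f (w 3)) = 0
  swap
  · exact step f hf 1 (by omega) h13
  obtain ⟨Φ, hc, h0, hΦ⟩ := exists_deformation_of_cross_eq (x := fun i => f (w i)) hm4
    (hne f hf) (horth f hf) h02 h13
  have h1 : f ∈ closure (R ∩ {f | crossProduct (f (w 0)) (f (w 2)) ≠ 0}) := by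
    refine h.mem_closure_of_deformation hf Φ hc h0
      (fun t => ⟨(hΦ t).1, (hΦ t).2.1, (hΦ t).2.2.1⟩) fun t ht g hg => ?_
    rw [mem_ofPred_eq, hg _ (by omega), hg _ (by omega)]
    exact (hΦ t).2.2.2 ht
  exact closure_minimal (fun g hg => step g hg.1 0 (by omega) hg.2) isClosed_closure h1

/-- The closing vertex `w (m + 1)` is added over the open locus where its neighbours `w m` and `w 0`
are not parallel, which gives an irreducible dense part. -/
theorem IsEar.isPreirreducible (h : IsEar G S w m) (hm : Even m) (hm4 : 4 ≤ m)
    (hS : IsPreirreducible (realizations G S)) :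
    IsPreirreducible (realizations G (S ∪ w '' Icc 1 (m + 1))) := by
  have hA := isPreirreducible_insert_of_cross (h.isPreirreducible_path hS le_rfl)
    (h.notMem_union le_rfl) (u := w m) (v := w 0) (Or.inr ⟨m, ⟨by omega, le_rfl⟩, rfl⟩)
    (Or.inl h.start_mem) (h.adj m le_rfl).symm h.adj_last
    (fun x hx hadj => (h.eq_of_adj le_rfl hx hadj).imp id fun h => h.2)
  rw [← union_image_Icc_succ] at hA
  exact IsPreirreducible.of_subset_closure hA inter_subset_left (h.subset_closure hm hm4)

end Ears

/-! ### Cactus graphs -/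

section CactusSets

variable {V : Type*} {G : SimpleGraph V}

/-- The vertex sets obtained by successively adding vertices with at most one earlier neighbour and
attaching induced cycles of even length at least six at one vertex. -/
inductive IsCactusSet (G : SimpleGraph V) : Set V → Prop
  | empty : IsCactusSet G ∅
  | vertex (S : Set V) (w : V) (hS : IsCactusSet G S) (hw : w ∉ S)
      (hN : ∀ u ∈ S, ∀ u' ∈ S, G.Adj w u → G.Adj w u' → u = u') : IsCactusSet G (insert w S)
  | ear (S : Set V) (w : ℕ → V) (m : ℕ) (hS : IsCactusSet G S) (hm : Even m) (hm4 : 4 ≤ m)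
      (h : IsEar G S w m) : IsCactusSet G (S ∪ w '' Icc 1 (m + 1))

theorem IsCactusSet.isPreirreducible {S : Set V} (h : IsCactusSet G S) :
    IsPreirreducible (realizations G S) := by
  induction h with
  | empty => exact realizations_empty
  | vertex S w _ hw hN ih => exact isPreirreducible_insert ih hw hN
  | ear S w m _ hm hm4 h ih => exact h.isPreirreducible hm hm4 ih

theorem IsCactusSet.insert' {S : Set V} (h : IsCactusSet G S) (w : V)
    (hN : w ∉ S → ∀ u ∈ S, ∀ u' ∈ S, G.Adj w u → G.Adj w u' → u = u') :
    IsCactusSet G (insert w S) := by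
  by_cases hw : w ∈ S
  · rwa [insert_eq_of_mem hw]
  · exact .vertex S w h hw (hN hw)

theorem IsCactusSet.insert_diff {S D : Set V} {w : V} (h : IsCactusSet G (S \ D))
    (hN : w ∉ D → ∀ u ∈ S, u ∉ D → ∀ u' ∈ S, u' ∉ D → G.Adj w u → G.Adj w u' → u = u') :
    IsCactusSet G (insert w S \ D) := by
  by_cases hw : w ∈ D
  · rwa [insert_sdiff_of_mem _ hw]
  · rw [insert_sdiff_of_notMem _ hw]
    exact h.insert' w fun _ u hu u' hu' => hN hw u hu.1 hu.2 u' hu'.1 hu'.2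

/-- A cycle that loses a vertex breaks into paths, whose vertices can be added one at a time:
upwards from `w 0` to `w (j - 1)`, then downwards from `w (m + 1)` to `w (j + 1)`. -/
theorem IsEar.isCactusSet_diff {S D : Set V} {w : ℕ → V} {m j : ℕ} (h : IsEar G S w m)
    (hS : IsCactusSet G (S \ D)) (hj : j ≤ m + 1) (hjD : w j ∈ D) :
    IsCactusSet G ((S ∪ w '' Icc 1 (m + 1)) \ D) := by
  -- The alternative `k = 0` covers `j = 0`, where `j - 1` truncates to `0` and the upward path is
  -- empty.
  have up : ∀ k, k < j ∨ k = 0 → IsCactusSet G ((S ∪ w '' Icc 1 k) \ D) := by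
    intro k
    induction k with
    | zero => intro _; simpa using hS
    | succ k ih =>
      intro hk
      rw [union_image_Icc_succ]
      refine (ih (by omega)).insert_diff fun _ u hu huD u' hu' hu'D h1 h2 => ?_
      rcases h.eq_of_adj (by omega) hu h1 with rfl | h1
      · rcases h.eq_of_adj (by omega) hu' h2 with rfl | h2
        · rfl
        · omega
      · omega
  have down : ∀ n, j + n ≤ m + 1 →
      IsCactusSet G ((S ∪ w '' Icc 1 (j - 1) ∪ w '' Icc (m + 2 - n) (m + 1)) \ D) := by
    intro n
    induction n with
    | zero =>
      intro _
      simpa using up (j - 1) (by omega)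
    | succ n ih =>
      intro hn
      have e : Icc (m + 2 - (n + 1)) (m + 1) = insert (m + 1 - n) (Icc (m + 2 - n) (m + 1)) := by
        ext i; simp only [mem_Icc, mem_insert_iff]; omega
      rw [e, image_insert_eq, union_insert]
      refine (ih (by omega)).insert_diff fun _ => ?_
      have key : ∀ u ∈ S ∪ w '' Icc 1 (j - 1) ∪ w '' Icc (m + 2 - n) (m + 1), u ∉ D →
          G.Adj (w (m + 1 - n)) u → (n = 0 ∧ u = w 0) ∨ (n ≠ 0 ∧ u = w (m + 2 - n)) := by
        rintro u ((hu | ⟨i, ⟨hi1, hi2⟩, rfl⟩) | ⟨i, ⟨hi1, hi2⟩, rfl⟩) huD hadj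
        · obtain ⟨rfl, h1⟩ := h.attach _ (by omega) (by omega) u hu hadj
          have hj0 : j ≠ 0 := by
            rintro rfl
            exact huD hjD
          exact Or.inl ⟨by omega, rfl⟩
        · have := h.chord i _ hi1 (by omega) (by omega) hadj.symm
          omega
        · have := h.chord _ i (by omega) (by omega) (by omega) hadj
          exact Or.inr ⟨by omega, by rw [this]; congr 1; omega⟩
      intro u hu huD u' hu' hu'D h1 h2
      rcases key u hu huD h1 with ⟨a, rfl⟩ | ⟨a, rfl⟩ <;>
        rcases key u' hu' hu'D h2 with ⟨b, rfl⟩ | ⟨b, rfl⟩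
      · rfl
      · omega
      · omega
      · rfl
  have hfin := down (m + 1 - j) (by omega)
  convert hfin using 1
  ext v
  simp only [Set.mem_sdiff, mem_union, mem_image, mem_Icc]
  refine and_congr_left fun hvD => ⟨?_, ?_⟩
  · rintro (hv | ⟨i, hi, rfl⟩)
    · exact Or.inl (Or.inl hv)
    · have : i ≠ j := by rintro rfl; exact hvD hjD
      rcases lt_or_gt_of_ne this with hlt | hlt
      · exact Or.inl (Or.inr ⟨i, by omega, rfl⟩)
      · exact Or.inr ⟨i, by omega, rfl⟩
  · rintro ((hv | ⟨i, hi, rfl⟩) | ⟨i, hi, rfl⟩)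
    · exact Or.inl hv
    · exact Or.inr ⟨i, by omega, rfl⟩
    · exact Or.inr ⟨i, by omega, rfl⟩

/-- Turning points into loops deletes their vertices from the incidence graph; this closure property
lets one argument serve every `J`. -/
theorem IsCactusSet.diff {S : Set V} (h : IsCactusSet G S) (D : Set V) :
    IsCactusSet G (S \ D) := by
  induction h with
  | empty => simpa using IsCactusSet.empty
  | vertex S w _ hw hN ih =>
    exact ih.insert_diff fun _ u hu _ u' hu' _ => hN u hu u' hu'
  | ear S w m _ hm hm4 h ih =>
    by_cases hD : ∃ j ≤ m + 1, w j ∈ D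
    · obtain ⟨j, hj, hjD⟩ := hD
      exact h.isCactusSet_diff ih hj hjD
    · push Not at hD
      have e : (S ∪ w '' Icc 1 (m + 1)) \ D = S \ D ∪ w '' Icc 1 (m + 1) := by
        rw [union_sdiff_distrib]
        congr 1
        rw [sdiff_eq_left]
        refine disjoint_left.2 ?_
        rintro _ ⟨i, hi, rfl⟩
        exact hD i hi.2
      rw [e]
      exact .ear _ w m ih hm hm4
        { start_mem := ⟨h.start_mem, hD 0 (by omega)⟩
          notMem := fun i h1 h2 h3 => h.notMem i h1 h2 h3.1
          inj := h.inj
          adj := h.adj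
          adj_last := h.adj_last
          attach := fun i h1 h2 u hu => h.attach i h1 h2 u hu.1
          chord := h.chord }

theorem IsCactusSet.union {S T : Set V} (hS : IsCactusSet G S) (hT : IsCactusSet G T)
    (hd : ∀ u ∈ S, u ∉ T) (hadj : ∀ u ∈ S, ∀ v ∈ T, ¬ G.Adj v u) : IsCactusSet G (S ∪ T) := by
  induction hT with
  | empty => simpa using hS
  | vertex T w _ hw hN ih =>
    rw [union_insert]
    refine (ih (fun u hu hu' => hd u hu (Or.inr hu'))
      fun u hu v hv => hadj u hu v (Or.inr hv)).insert' w fun _ u hu u' hu' h1 h2 => ?_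
    have h3 : ∀ u ∈ S ∪ T, G.Adj w u → u ∈ T := fun u hu h =>
      hu.resolve_left fun hu => hadj u hu w (Or.inl rfl) h
    exact hN u (h3 u hu h1) u' (h3 u' hu' h2) h1 h2
  | ear T w m _ hm hm4 h ih =>
    rw [← union_assoc]
    have hmem : ∀ i, 1 ≤ i → i ≤ m + 1 → w i ∈ T ∪ w '' Icc 1 (m + 1) := fun i h1 h2 =>
      Or.inr ⟨i, ⟨h1, h2⟩, rfl⟩
    refine .ear _ w m (ih (fun u hu hu' => hd u hu (Or.inl hu'))
      fun u hu v hv => hadj u hu v (Or.inl hv)) hm hm4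
        { start_mem := Or.inr h.start_mem
          notMem := fun i h1 h2 h3 => h3.elim (fun h3 => hd _ h3 (hmem i h1 h2)) (h.notMem i h1 h2)
          inj := h.inj
          adj := h.adj
          adj_last := h.adj_last
          attach := fun i h1 h2 u hu hau => h.attach i h1 h2 u
            (hu.resolve_left fun hu => hadj u hu _ (hmem i h1 h2) hau) hau
          chord := h.chord }

end CactusSets

/-! ### Lines of simple matroids -/

section Lines

variable {α : Type*} {M : Matroid α}

theorem IsSimple.indep_of_encard_le (hM : IsSimple M) {I : Set α} (hI : I ⊆ M.E)
    (h : I.encard ≤ 2) : M.Indep I := by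
  obtain ⟨x, y, hxy⟩ | hI0 : (∃ x y, I ⊆ {x, y}) ∨ I = ∅ := by
    rcases h.lt_or_eq with h1 | h1
    · have h1 : I.encard ≤ 1 := Order.le_of_lt_add_one (by rwa [one_add_one_eq_two])
      rcases encard_le_one_iff_eq.1 h1 with h | ⟨x, rfl⟩
      · exact Or.inr h
      · exact Or.inl ⟨x, x, by simp⟩
    · obtain ⟨x, y, -, rfl⟩ := encard_eq_two.1 h1
      exact Or.inl ⟨x, y, subset_rfl⟩
  · by_contra hc
    obtain ⟨C, hCI, hC⟩ := Matroid.Dep.exists_isCircuit_subset ((M.not_indep_iff hI).1 hc)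
    rcases subset_pair_iff_eq.1 (hCI.trans hxy) with rfl | rfl | rfl | rfl
    · exact hC.nonempty.ne_empty rfl
    · exact hM x x (by simpa using hC)
    · exact hM y y (by simpa using hC)
    · exact hM x y hC
  · rw [hI0]; exact M.empty_indep

theorem IsSimple.two_lt_encard (hM : IsSimple M) {I : Set α} (hI : M.Dep I) : 2 < I.encard := by
  by_contra hc
  exact hI.not_indep (hM.indep_of_encard_le hI.subset_ground (not_lt.1 hc))

theorem IsLine.subset_ground {l : Set α} (h : IsLine M l) : l ⊆ M.E := h.prop.1.subset_ground

theorem exists_isLine_of_dep [Finite α] {t : Set α} (ht : M.Dep t) (h3 : t.encard = 3) :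
    ∃ l, IsLine M l ∧ t ⊆ l := by
  obtain ⟨l, hl, hmax⟩ := (toFinite {s : Set α | M.Dep s ∧ ∀ t ⊆ s, t.encard = 3 → M.Dep t}
    ).exists_le_maximal (a := t) ⟨ht, fun t' ht' h3' => by
      have e : t' = t := (toFinite t').eq_of_subset_of_encard_le ht' (by rw [h3, h3'])
      rwa [e]⟩
  exact ⟨l, hmax, hl⟩

theorem IsSimple.subset_closure_of_isLine (hM : IsSimple M) {l : Set α} (hl : IsLine M l) {x y : α}
    (hxy : x ≠ y) (hx : x ∈ l) (hy : y ∈ l) : l ⊆ M.closure {x, y} := by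
  have hI : M.Indep {x, y} := hM.indep_of_encard_le
    (pair_subset (hl.subset_ground hx) (hl.subset_ground hy)) (encard_pair hxy).le
  intro z hz
  rw [hI.mem_closure_iff]
  by_cases h : z ∈ ({x, y} : Set α)
  · exact Or.inr h
  · refine Or.inl (hl.prop.2 _ (insert_subset hz (pair_subset hx hy)) ?_)
    rw [encard_insert_of_notMem h, encard_pair hxy]; rfl

/-- Both lines lie in the closure of `{x, y}`, which has rank at most two, so all triples in their
union are dependent and maximality applies. -/
theorem IsSimple.isLine_eq (hM : IsSimple M) {l l' : Set α} (hl : IsLine M l) (hl' : IsLine M l')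
    {x y : α} (hxy : x ≠ y) (hx : x ∈ l) (hy : y ∈ l) (hx' : x ∈ l') (hy' : y ∈ l') : l = l' := by
  have hsub : l ∪ l' ⊆ M.closure {x, y} := union_subset
    (hM.subset_closure_of_isLine hl hxy hx hy) (hM.subset_closure_of_isLine hl' hxy hx' hy')
  have hP : M.Dep (l ∪ l') ∧ ∀ t ⊆ l ∪ l', t.encard = 3 → M.Dep t := by
    refine ⟨hl.prop.1.superset subset_union_left
      (union_subset hl.subset_ground hl'.subset_ground), fun t ht h3 => ?_⟩
    rw [← M.not_indep_iff (ht.trans (hsub.trans (M.closure_subset_ground _)))]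
    intro hI
    have h1 := hI.encard_le_eRk_of_subset (ht.trans hsub)
    rw [M.eRk_closure_eq, h3] at h1
    have h2 := h1.trans (M.eRk_le_encard {x, y})
    rw [encard_pair hxy] at h2
    exact absurd h2 (by decide)
  rw [hl.eq_of_subset hP subset_union_left, ← hl'.eq_of_subset hP subset_union_right]

theorem IsLineMatroid.two_lt_encard (hM : IsLineMatroid M) {I : Set α} (hI : M.Dep I) :
    2 < I.encard := by
  by_contra hc
  exact hI.not_indep ((hM I hI.subset_ground).2 (not_lt.1 hc))

theorem IsLineMatroid.eq_ground_of_isLine (hM : IsLineMatroid M) {l : Set α} (hl : IsLine M l) :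
    l = M.E := by
  have hdep : ∀ t ⊆ M.E, 2 < t.encard → M.Dep t := fun t ht h => by
    rw [← M.not_indep_iff ht, hM t ht]
    exact not_le.2 h
  refine hl.eq_of_subset ⟨hdep _ subset_rfl ?_, fun t ht h3 => hdep t ht ?_⟩ hl.subset_ground
  · exact (hM.two_lt_encard hl.prop.1).trans_le (encard_le_encard hl.subset_ground)
  · rw [h3]; decide

end Lines

/-! ### The incidence graph -/

section Levi

variable {α : Type*}

/-- The incidence graph of points and sets of points. -/
def leviGraph (α : Type*) : SimpleGraph (α ⊕ Set α) where
  Adj u v := (∃ p l, p ∈ l ∧ u = Sum.inl p ∧ v = Sum.inr l) ∨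
    (∃ p l, p ∈ l ∧ v = Sum.inl p ∧ u = Sum.inr l)
  symm := ⟨fun _ _ h => h.symm⟩
  loopless := ⟨fun u h => by rcases h with ⟨p, l, -, rfl, h⟩ | ⟨p, l, -, rfl, h⟩ <;> cases h⟩

@[simp] theorem leviGraph_adj_inl_inr {p : α} {l : Set α} :
    (leviGraph α).Adj (Sum.inl p) (Sum.inr l) ↔ p ∈ l := by simp [leviGraph]

@[simp] theorem leviGraph_adj_inr_inl {p : α} {l : Set α} :
    (leviGraph α).Adj (Sum.inr l) (Sum.inl p) ↔ p ∈ l := by simp [leviGraph]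

@[simp] theorem leviGraph_not_adj_inl_inl {p q : α} :
    ¬ (leviGraph α).Adj (Sum.inl p) (Sum.inl q) := by simp [leviGraph]

@[simp] theorem leviGraph_not_adj_inr_inr {l l' : Set α} :
    ¬ (leviGraph α).Adj (Sum.inr l) (Sum.inr l') := by simp [leviGraph]

/-- The vertices of the incidence graph that are points or lines of `M`. -/
def leviVertices (M : Matroid α) : Set (α ⊕ Set α) := Sum.inl '' M.E ∪ Sum.inr '' lines M

@[simp] theorem inl_mem_leviVertices {M : Matroid α} {p : α} :
    Sum.inl p ∈ leviVertices M ↔ p ∈ M.E := by simp [leviVertices]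

@[simp] theorem inr_mem_leviVertices {M : Matroid α} {l : Set α} :
    Sum.inr l ∈ leviVertices M ↔ IsLine M l := by simp [leviVertices, lines]

theorem IsCactusSet.union_points {S : Set (α ⊕ Set α)} (hS : IsCactusSet (leviGraph α) S)
    {T : Set α} (hT : T.Finite) (h : ∀ x ∈ T, Sum.inl x ∉ S → ∀ l l', Sum.inr l ∈ S →
      Sum.inr l' ∈ S → x ∈ l → x ∈ l' → l = l') :
    IsCactusSet (leviGraph α) (S ∪ Sum.inl '' T) := by
  induction T, hT using Set.Finite.induction_on with
  | empty => simpa using hS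
  | @insert a T ha hT ih =>
    rw [image_insert_eq, union_insert]
    refine (ih fun x hx => h x (Or.inr hx)).insert' _ fun haS u hu u' hu' h1 h2 => ?_
    rcases u with p | l
    · exact absurd h1 leviGraph_not_adj_inl_inl
    rcases u' with p | l'
    · exact absurd h2 leviGraph_not_adj_inl_inl
    have hl : Sum.inr l ∈ S := by simpa using hu
    have hl' : Sum.inr l' ∈ S := by simpa using hu'
    rw [h a (Or.inl rfl) (fun h => haS (Or.inl h)) l l' hl hl' (by simpa using h1)
      (by simpa using h2)]

/-- Indexing the cycle by natural numbers modulo `m + 2` turns a rotation to the attaching vertex `c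
s` into a shift. -/
theorem isEar_of_cyclic {V : Type*} {G : SimpleGraph V} {S : Set V} {c : ℕ → V} {m s : ℕ}
    (hm : 1 ≤ m) (hc : ∀ a b, c a = c b ↔ a ≡ b [MOD m + 2])
    (hadj : ∀ a b, G.Adj (c a) (c b) ↔ (b ≡ a + 1 [MOD m + 2] ∨ a ≡ b + 1 [MOD m + 2]))
    (hs : c s ∈ S) (hd : ∀ k, c k ∈ S → c k = c s)
    (ha : ∀ k, c k ≠ c s → ∀ u ∈ S, G.Adj (c k) u → u = c s) :
    IsEar G S (fun i => c (s + i)) m ∧ S ∪ (fun i => c (s + i)) '' Icc 1 (m + 1) = S ∪ range c := by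
  have hinj : ∀ i j, i ≤ m + 1 → j ≤ m + 1 → c (s + i) = c (s + j) → i = j := by
    intro i j hi hj h
    rw [hc] at h
    exact (Nat.ModEq.add_left_cancel' s h).eq_of_lt_of_lt (by omega) (by omega)
  have hA : ∀ i j, i ≤ m + 1 → j ≤ m + 1 → G.Adj (c (s + i)) (c (s + j)) →
      j = i + 1 ∨ i = j + 1 ∨ (i = 0 ∧ j = m + 1) ∨ (i = m + 1 ∧ j = 0) := by
    have aux : ∀ i j, i ≤ m + 1 → j ≤ m + 1 → s + j ≡ s + i + 1 [MOD m + 2] →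
        j = i + 1 ∨ (i = m + 1 ∧ j = 0) := by
      intro i j hi hj h
      rw [add_assoc] at h
      have h := Nat.ModEq.add_left_cancel' s h
      rcases eq_or_lt_of_le hi with rfl | hi
      · have : j ≡ 0 [MOD m + 2] := h.trans (by simp [Nat.ModEq])
        exact Or.inr ⟨rfl, this.eq_of_lt_of_lt (by omega) (by omega)⟩
      · exact Or.inl (h.eq_of_lt_of_lt (by omega) (by omega))
    intro i j hi hj h
    rcases (hadj _ _).1 h with h | h
    · rcases aux i j hi hj h with h | h <;> omega
    · rcases aux j i hj hi h with h | h <;> omega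
  have hne : ∀ i, 1 ≤ i → i ≤ m + 1 → c (s + i) ≠ c s := fun i h1 h2 h => by
    have := hinj i 0 h2 (by omega) h
    omega
  refine ⟨⟨hs, fun i h1 h2 h3 => hne i h1 h2 (hd _ h3), hinj, fun i hi => ?_, ?_,
    fun i h1 h2 u hu hau => ?_, fun i j h1 h2 h3 h => ?_⟩, ?_⟩
  · rw [hadj]; exact Or.inl rfl
  · rw [hadj]
    refine Or.inl ?_
    have : s + (m + 1) + 1 = s + (m + 2) := by omega
    rw [this]
    simp [Nat.ModEq]
  · obtain rfl := ha _ (hne i h1 h2) u hu hau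
    refine ⟨rfl, ?_⟩
    have := hA i 0 h2 (by omega) hau
    omega
  · have := hA i j (by omega) h3 h
    omega
  · ext v
    constructor
    · rintro (h | ⟨i, -, rfl⟩)
      · exact Or.inl h
      · exact Or.inr ⟨_, rfl⟩
    · rintro (h | ⟨k, rfl⟩)
      · exact Or.inl h
      · obtain ⟨i, hi, hki⟩ : ∃ i ≤ m + 1, k ≡ s + i [MOD m + 2] := by
          obtain ⟨i, hi⟩ : ∃ i, k ≡ s + i [MOD m + 2] := by
            -- This represents k − s modulo `m + 2` without subtraction.
            refine ⟨k + s * (m + 1), ?_⟩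
            have : s + (k + s * (m + 1)) = k + s * (m + 2) := by ring
            rw [this]
            simp [Nat.ModEq]
          refine ⟨i % (m + 2), by have := Nat.mod_lt i (show 0 < m + 2 by omega); omega,
            hi.trans (Nat.ModEq.add_left s (Nat.mod_modEq _ _).symm)⟩
        rw [(hc _ _).2 hki]
        rcases Nat.eq_zero_or_pos i with rfl | hpos
        · exact Or.inl hs
        · exact Or.inr ⟨i, ⟨hpos, hi⟩, rfl⟩

/-- The alternating sequence of the lines `L i` and the points `p i`. -/
def alternating (L : ℕ → Set α) (p : ℕ → α) (k : ℕ) : α ⊕ Set α :=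
  if Even k then Sum.inr (L (k / 2)) else Sum.inl (p (k / 2))

theorem alternating_even (L : ℕ → Set α) (p : ℕ → α) (i : ℕ) :
    alternating L p (2 * i) = Sum.inr (L i) := by simp [alternating]

theorem alternating_odd (L : ℕ → Set α) (p : ℕ → α) (i : ℕ) :
    alternating L p (2 * i + 1) = Sum.inl (p i) := by
  have : (2 * i + 1) / 2 = i := by omega
  simp [alternating, this]

theorem two_mul_modEq_iff {i j n : ℕ} : 2 * i ≡ 2 * j [MOD 2 * n] ↔ i ≡ j [MOD n] :=
  ⟨fun h => Nat.ModEq.mul_left_cancel' two_ne_zero h, fun h => h.mul_left' 2⟩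

theorem not_modEq_of_parity {i j n : ℕ} : ¬ 2 * i ≡ 2 * j + 1 [MOD 2 * n] := by
  intro h
  have := h.of_mul_right n
  unfold Nat.ModEq at this
  omega

theorem alternating_eq_iff {L : ℕ → Set α} {p : ℕ → α} {n : ℕ}
    (hL : ∀ i j, L i = L j ↔ i ≡ j [MOD n]) (hp : ∀ i j, p i = p j ↔ i ≡ j [MOD n]) (a b : ℕ) :
    alternating L p a = alternating L p b ↔ a ≡ b [MOD 2 * n] := by
  rcases Nat.even_or_odd' a with ⟨i, rfl | rfl⟩ <;> rcases Nat.even_or_odd' b with ⟨j, rfl | rfl⟩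
  · rw [alternating_even, alternating_even, Sum.inr.injEq, hL, two_mul_modEq_iff]
  · rw [alternating_even, alternating_odd]
    exact iff_of_false (by simp) not_modEq_of_parity
  · rw [alternating_even, alternating_odd]
    exact iff_of_false (by simp) fun h => not_modEq_of_parity h.symm
  · rw [alternating_odd, alternating_odd, Sum.inl.injEq, hp, ← two_mul_modEq_iff]
    exact ⟨fun h => h.add_right 1, fun h => Nat.ModEq.add_right_cancel' 1 h⟩

theorem alternating_adj_iff {L : ℕ → Set α} {p : ℕ → α} {n : ℕ}
    (hinc : ∀ i j, p j ∈ L i ↔ (i ≡ j [MOD n] ∨ i ≡ j + 1 [MOD n])) (a b : ℕ) :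
    (leviGraph α).Adj (alternating L p a) (alternating L p b) ↔
      (b ≡ a + 1 [MOD 2 * n] ∨ a ≡ b + 1 [MOD 2 * n]) := by
  have key : ∀ i j, p j ∈ L i ↔
      (2 * j + 1 ≡ 2 * i + 1 [MOD 2 * n] ∨ 2 * i ≡ 2 * j + 1 + 1 [MOD 2 * n]) := by
    intro i j
    rw [hinc, ← two_mul_modEq_iff, ← two_mul_modEq_iff (i := i) (j := j + 1)]
    exact or_congr ⟨fun h => h.symm.add_right 1, fun h => (Nat.ModEq.add_right_cancel' 1 h).symm⟩
      Iff.rfl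
  rcases Nat.even_or_odd' a with ⟨i, rfl | rfl⟩ <;> rcases Nat.even_or_odd' b with ⟨j, rfl | rfl⟩
  · rw [alternating_even, alternating_even]
    refine iff_of_false leviGraph_not_adj_inr_inr ?_
    rintro (h | h) <;> exact not_modEq_of_parity h
  · rw [alternating_even, alternating_odd, leviGraph_adj_inr_inl, key]
  · rw [alternating_even, alternating_odd, leviGraph_adj_inl_inr, key, or_comm]
  · rw [alternating_odd, alternating_odd]
    refine iff_of_false leviGraph_not_adj_inl_inl ?_
    rintro (h | h)
    · exact not_modEq_of_parity (i := i + 1) (j := j) h.symm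
    · exact not_modEq_of_parity (i := j + 1) (j := i) h.symm

end Levi

/-! ### Cactus configurations have cactus incidence graphs -/

section Attach

variable {α : Type*} {N : Matroid α} {S : Set (α ⊕ Set α)} {P : α}

/-- The line, if there is one, is adjacent only to `P` among the earlier vertices, and each new
point is then adjacent only to this line. -/
theorem IsLineMatroid.isCactusSet_union [Finite α] (hN : IsLineMatroid N)
    (hS : IsCactusSet (leviGraph α) S) (hPS : Sum.inl P ∈ S)
    (hE : ∀ x ∈ N.E, Sum.inl x ∈ S → x = P)
    (hl : ∀ l, Sum.inr l ∈ S → ¬ IsLine N l ∧ ∀ x ∈ N.E, x ∈ l → x = P) :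
    IsCactusSet (leviGraph α) (S ∪ leviVertices N) := by
  have h1 : IsCactusSet (leviGraph α) (S ∪ Sum.inr '' lines N) := by
    by_cases h : IsLine N N.E
    · have e : lines N = {N.E} := by
        ext l
        exact ⟨fun hl => hN.eq_ground_of_isLine hl, by rintro rfl; exact h⟩
      rw [e, image_singleton, union_singleton]
      refine hS.insert' _ fun _ u hu u' hu' h1 h2 => ?_
      rcases u with x | l
      swap
      · exact absurd h1 leviGraph_not_adj_inr_inr
      rcases u' with x' | l
      swap
      · exact absurd h2 leviGraph_not_adj_inr_inr
      rw [hE x (by simpa using h1) hu, hE x' (by simpa using h2) hu']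
    · have e : lines N = ∅ := by
        refine eq_empty_of_forall_notMem fun l hl => h ?_
        have hl : IsLine N l := hl
        rwa [hN.eq_ground_of_isLine hl] at hl
      simpa [e] using hS
  have h2 := h1.union_points (T := N.E) (toFinite _) fun x hx hxS l l' hlS hlS' hxl hxl' => by
    have key : ∀ l, Sum.inr l ∈ S ∪ Sum.inr '' lines N → x ∈ l → l = N.E := by
      rintro l (h | ⟨l', h, h'⟩) hxl
      · rw [(hl l h).2 x hx hxl] at hxS
        exact absurd (Or.inl hPS) hxS
      · cases h'
        exact hN.eq_ground_of_isLine h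
    rw [key l hlS hxl, key l' hlS' hxl']
  convert h2 using 1
  rw [leviVertices, union_assoc, union_comm (Sum.inl '' N.E)]

theorem IsCycleMatroid.exists_cyclic_sequence (hN : IsCycleMatroid N) :
    ∃ (n : ℕ) (L : ℕ → Set α) (p : ℕ → α), 3 ≤ n ∧
      (∀ i j, L i = L j ↔ i ≡ j [MOD n]) ∧ (∀ i j, p i = p j ↔ i ≡ j [MOD n]) ∧
      (∀ i j, p j ∈ L i ↔ (i ≡ j [MOD n] ∨ i ≡ j + 1 [MOD n])) ∧
      (∀ i, p i ∈ N.E) ∧ (∀ l, IsLine N l ↔ ∃ i, L i = l) ∧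
      ∀ x ∈ N.E, x ∉ range p → (linesThrough N x).encard = 1 := by
  obtain ⟨hs, -, n, p, l, hp, hpE, hl, hlr, hthr, hdeg⟩ := hN
  have hline : ∀ i, IsLine N (l i) := fun i => by
    have : l i ∈ lines N := hlr ▸ mem_range_self i
    exact this
  have hthr' : ∀ i j, p j ∈ l i ↔ (i = j ∨ i = j + 1) := by
    intro i j
    have : l i ∈ linesThrough N (p j) ↔ p j ∈ l i := by simp [linesThrough, hline]
    rw [← this, (hthr j).1]
    simp [hl.eq_iff]
  -- A single line cannot give degree two, and two distinct lines cannot share two points. Hence the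
  -- cycle in the incidence graph has length at least six.
  have hn : 3 ≤ n + 1 := by
    by_contra hc
    obtain rfl | rfl : n = 0 ∨ n = 1 := by omega
    · have := (hthr 0).2
      rw [(hthr 0).1] at this
      simp at this
    · have h01 : l 0 = l 1 := hs.isLine_eq (hline 0) (hline 1) (hp.ne (show (0 : Fin 2) ≠ 1 by decide))
        ((hthr' 0 0).2 (by decide)) ((hthr' 0 1).2 (by decide)) ((hthr' 1 0).2 (by decide))
        ((hthr' 1 1).2 (by decide))
      exact absurd (hl h01) (by decide)
  have hof : ∀ i j : ℕ, Fin.ofNat (n + 1) i = Fin.ofNat (n + 1) j ↔ i ≡ j [MOD n + 1] := by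
    intro i j
    rw [Fin.ext_iff]
    rfl
  have hsucc : ∀ i : ℕ, Fin.ofNat (n + 1) (i + 1) = Fin.ofNat (n + 1) i + 1 := by
    intro i
    ext
    simp [Fin.val_add]
  have hsurj : ∀ i : Fin (n + 1), Fin.ofNat (n + 1) i = i := fun i => by
    ext; simp
  refine ⟨n + 1, fun i => l (Fin.ofNat _ i), fun i => p (Fin.ofNat _ i), hn, fun i j => ?_,
    fun i j => ?_, fun i j => ?_, fun i => hpE _, fun k => ?_, fun x hx hxp => ?_⟩
  · rw [hl.eq_iff, hof]
  · rw [hp.eq_iff, hof]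
  · rw [hthr', ← hsucc, hof, hof]
  · constructor
    · intro hk
      obtain ⟨i, rfl⟩ : k ∈ range l := hlr ▸ hk
      exact ⟨i, by simp only [hsurj]⟩
    · rintro ⟨i, rfl⟩
      exact hline _
  · refine hdeg x hx ?_
    rintro ⟨i, rfl⟩
    exact hxp ⟨i, by simp only [hsurj]⟩

/-- If `P` is one of the corners `p j`, the incidence cycle is an ear attached at `P`. Otherwise `P`
lies on a single line `L j`; this line is added as a pendant vertex and the ear is attached there.
The remaining points lie on one line each. The set `S'` records `S` with or without the extra line.
-/
theorem IsCycleMatroid.isCactusSet_union [Finite α] (hN : IsCycleMatroid N)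
    (hS : IsCactusSet (leviGraph α) S) (hP : P ∈ N.E) (hPS : Sum.inl P ∈ S)
    (hE : ∀ x ∈ N.E, Sum.inl x ∈ S → x = P)
    (hl : ∀ l, Sum.inr l ∈ S → ¬ IsLine N l ∧ ∀ x ∈ N.E, x ∈ l → x = P) :
    IsCactusSet (leviGraph α) (S ∪ leviVertices N) := by
  obtain ⟨n, L, p, hn, hL, hp, hinc, hpE, hlines, hdeg⟩ := hN.exists_cyclic_sequence
  set c := alternating L p with hcdef
  obtain ⟨m, hm⟩ : ∃ m, 2 * n = m + 2 := ⟨2 * n - 2, by omega⟩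
  have hc := alternating_eq_iff hL hp
  have hadj := alternating_adj_iff hinc
  rw [hm, ← hcdef] at hc hadj
  have hline : ∀ i, IsLine N (L i) := fun i => (hlines _).2 ⟨i, rfl⟩
  have hcm : ∀ k, (∃ i, c k = Sum.inr (L i)) ∨ ∃ i, c k = Sum.inl (p i) := by
    intro k
    rcases Nat.even_or_odd' k with ⟨i, rfl | rfl⟩
    · exact Or.inl ⟨i, alternating_even L p i⟩
    · exact Or.inr ⟨i, alternating_odd L p i⟩
  have hmem : ∀ x l, IsLine N l → x ∈ l → Sum.inl x ∈ S → x = P := fun x l hl hx hxS =>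
    hE x (hl.subset_ground hx) hxS
  obtain ⟨S', hSS', hS'S, hS'⟩ : ∃ S', S ⊆ S' ∧ S' ⊆ S ∪ Sum.inr '' lines N ∧
      IsCactusSet (leviGraph α) (S' ∪ range c) := by
    by_cases hPp : P ∈ range p
    · obtain ⟨j, rfl⟩ := hPp
      have hcs : c (2 * j + 1) = Sum.inl (p j) := alternating_odd L p j
      obtain ⟨hear, he⟩ := isEar_of_cyclic (G := leviGraph α) (S := S) (s := 2 * j + 1)
        (by omega) hc hadj (by rw [hcs]; exact hPS) (fun k hk => by
          rw [hcs]
          rcases hcm k with ⟨i, h⟩ | ⟨i, h⟩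
          · rw [h] at hk
            exact absurd (hline i) (hl _ hk).1
          · rw [h] at hk ⊢
            rw [hE _ (hpE i) hk]) (fun k hk u hu huk => by
          rw [hcs] at hk ⊢
          rcases hcm k with ⟨i, h⟩ | ⟨i, h⟩ <;> rw [h] at huk hk
          · rcases u with x | l
            · rw [hmem x _ (hline i) (by simpa using huk) hu]
            · simp at huk
          · rcases u with x | l
            · simp at huk
            · rw [(hl l hu).2 _ (hpE i) (by simpa using huk)] at hk
              exact absurd rfl hk)
      refine ⟨S, subset_rfl, subset_union_left, ?_⟩
      rw [← he]
      exact .ear _ _ m hS (by rw [Nat.even_iff]; omega) (by omega) hear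
    · obtain ⟨l, hlP⟩ := encard_eq_one.1 (hdeg P hP hPp)
      have hl1 : IsLine N l ∧ P ∈ l := by
        have : l ∈ linesThrough N P := by rw [hlP]; rfl
        exact this
      obtain ⟨j, rfl⟩ := (hlines l).1 hl1.1
      have hcs : c (2 * j) = Sum.inr (L j) := alternating_even L p j
      have hS1 : IsCactusSet (leviGraph α) (insert (Sum.inr (L j)) S) := by
        refine hS.insert' _ fun _ u hu u' hu' h1 h2 => ?_
        rcases u with x | l
        swap
        · simp at h1
        rcases u' with x' | l
        swap
        · simp at h2
        rw [hmem x _ (hline j) (by simpa using h1) hu, hmem x' _ (hline j) (by simpa using h2) hu']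
      obtain ⟨hear, he⟩ := isEar_of_cyclic (G := leviGraph α) (S := insert (Sum.inr (L j)) S)
        (s := 2 * j) (by omega) hc hadj (by rw [hcs]; exact Or.inl rfl) (fun k hk => by
          rw [hcs]
          rcases hk with hk | hk
          · exact hk
          rcases hcm k with ⟨i, h⟩ | ⟨i, h⟩ <;> rw [h] at hk
          · exact absurd (hline i) (hl _ hk).1
          · exact absurd ⟨i, hE _ (hpE i) hk⟩ hPp) (fun k hk u hu huk => by
          rw [hcs] at hk ⊢
          rcases hu with hu | hu
          · exact hu
          exfalso
          rcases hcm k with ⟨i, h⟩ | ⟨i, h⟩ <;> rw [h] at huk hk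
          · rcases u with x | l
            · have hx : x ∈ L i := by simpa using huk
              rw [hmem x _ (hline i) hx hu] at hx
              have : L i ∈ linesThrough N P := ⟨hline i, hx⟩
              rw [hlP] at this
              exact hk (congrArg Sum.inr this)
            · simp at huk
          · rcases u with x | l
            · simp at huk
            · exact hPp ⟨i, (hl l hu).2 _ (hpE i) (by simpa using huk)⟩)
      refine ⟨insert (Sum.inr (L j)) S, subset_insert _ _,
        insert_subset (Or.inr ⟨_, hline j, rfl⟩) subset_union_left, ?_⟩
      rw [← he]
      exact .ear _ _ m hS1 (by rw [Nat.even_iff]; omega) (by omega) hear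
  have h2 := hS'.union_points (T := N.E) (toFinite _) fun x hx hxS l l' hlS hlS' hxl hxl' => by
    have hxp : x ∉ range p := by
      rintro ⟨i, rfl⟩
      exact hxS (Or.inr ⟨2 * i + 1, alternating_odd L p i⟩)
    obtain ⟨l₀, hl₀⟩ := encard_eq_one.1 (hdeg x hx hxp)
    have key : ∀ l, Sum.inr l ∈ S' ∪ range c → x ∈ l → l = l₀ := by
      intro l h hxl
      have hline' : IsLine N l := by
        rcases h with h | ⟨k, h⟩
        · rcases hS'S h with h | ⟨l', h, h'⟩
          · rw [(hl l h).2 x hx hxl] at hxS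
            exact absurd (Or.inl (hSS' hPS)) hxS
          · cases h'
            exact h
        · rcases hcm k with ⟨i, h'⟩ | ⟨i, h'⟩ <;> rw [h'] at h <;> cases h
          exact hline i
      have : l ∈ linesThrough N x := ⟨hline', hxl⟩
      rwa [hl₀] at this
    rw [key l hlS hxl, key l' hlS' hxl']
  convert h2 using 1
  apply subset_antisymm
  · rintro v (h | ⟨x, hx, rfl⟩ | ⟨l, h, rfl⟩)
    · exact Or.inl (Or.inl (hSS' h))
    · exact Or.inr ⟨x, hx, rfl⟩
    · obtain ⟨i, rfl⟩ := (hlines l).1 h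
      exact Or.inl (Or.inr ⟨2 * i, alternating_even L p i⟩)
  · rintro v ((h | ⟨k, rfl⟩) | ⟨x, hx, rfl⟩)
    · exact (hS'S h).imp id Or.inr
    · rcases hcm k with ⟨i, h⟩ | ⟨i, h⟩ <;> rw [h]
      · exact Or.inr (Or.inr ⟨_, hline i, rfl⟩)
      · exact Or.inr (Or.inl ⟨_, hpE i, rfl⟩)
    · exact Or.inr (Or.inl ⟨x, hx, rfl⟩)

theorem isCactusSet_union_leviVertices [Finite α] (hN : IsLineMatroid N ∨ IsCycleMatroid N)
    (hS : IsCactusSet (leviGraph α) S) (hP : P ∈ N.E) (hPS : Sum.inl P ∈ S)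
    (hE : ∀ x ∈ N.E, Sum.inl x ∈ S → x = P)
    (hl : ∀ l, Sum.inr l ∈ S → ¬ IsLine N l ∧ ∀ x ∈ N.E, x ∈ l → x = P) :
    IsCactusSet (leviGraph α) (S ∪ leviVertices N) :=
  hN.elim (fun hN => hN.isCactusSet_union hS hPS hE hl)
    fun hN => hN.isCactusSet_union hS hP hPS hE hl

theorem IsConnectedCactus.isCactusSet [Finite α] {M : Matroid α} (hM : IsConnectedCactus M) :
    IsCactusSet (leviGraph α) (leviVertices M) := by
  induction hM with
  | base N hN =>
    rcases N.E.eq_empty_or_nonempty with h | ⟨P, hP⟩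
    · have : leviVertices N = ∅ := by
        refine eq_empty_of_forall_notMem ?_
        rintro (x | l) hx
        · simp [h] at hx
        · have hl : IsLine N l := by simpa using hx
          have h0 : l = ∅ := subset_empty_iff.1 (h ▸ hl.subset_ground)
          exact hl.prop.1.not_indep (h0 ▸ N.empty_indep)
      rw [this]
      exact .empty
    · have h1 : IsCactusSet (leviGraph α) {Sum.inl P} := by
        have := IsCactusSet.empty (G := leviGraph α)
        simpa using this.insert' (Sum.inl P) (by simp)
      have h2 := isCactusSet_union_leviVertices hN h1 hP rfl (fun x _ hx => by simpa using hx)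
        (fun l hl => by simp at hl)
      rwa [union_eq_self_of_subset_left (by simpa using hP)] at h2
  | glue M N K P _ hN hK ih =>
    obtain ⟨hMN, hKs, -, hKE, hKl⟩ := hK
    have hPMN : P ∈ M.E ∩ N.E := by rw [hMN]; rfl
    have hE : ∀ x ∈ M.E, x ∈ N.E → x = P := fun x h1 h2 => by
      have : x ∈ M.E ∩ N.E := ⟨h1, h2⟩
      rwa [hMN] at this
    have e : leviVertices K = leviVertices M ∪ leviVertices N := by
      simp only [leviVertices, hKE, hKl, image_union]
      exact union_union_union_comm _ _ _ _
    rw [e]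
    refine isCactusSet_union_leviVertices hN ih hPMN.2 (by simpa using hPMN.1)
      (fun x hx hxM => hE x (by simpa using hxM) hx) fun l hl => ?_
    have hl : IsLine M l := by simpa using hl
    refine ⟨fun hl' => ?_, fun x hx hxl => hE x (hl.subset_ground hxl) hx⟩
    have hlK : IsLine K l := by
      have : l ∈ lines K := hKl ▸ Or.inl hl
      exact this
    -- A line common to both parts would be contained in `{P}`, while lines have more than two
    -- points.
    have h1 := hKs.two_lt_encard hlK.prop.1
    have h2 : l ⊆ {P} := hMN ▸ subset_inter hl.subset_ground hl'.subset_ground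
    have h3 := h1.trans_le (encard_le_encard h2)
    rw [encard_singleton] at h3
    exact absurd h3 (by decide)

end Attach

/-! ### Connected components -/

section Components

variable {α : Type*} {M : Matroid α}

theorem mem_component_self (x : α) : x ∈ component M x := Relation.ReflTransGen.refl

theorem component_eq {x y : α} (h : y ∈ component M x) : component M y = component M x := by
  have hs : Std.Symm (fun a b : α => ∃ l, IsLine M l ∧ a ∈ l ∧ b ∈ l) :=
    ⟨fun a b ⟨l, h1, h2, h3⟩ => ⟨l, h1, h3, h2⟩⟩
  have h' : x ∈ component M y := Relation.ReflTransGen.stdSymm.symm _ _ h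
  ext z
  exact ⟨fun hz => h.trans hz, fun hz => h'.trans hz⟩

theorem component_subset_ground {x : α} (hx : x ∈ M.E) : component M x ⊆ M.E := by
  intro y hy
  induction hy with
  | refl => exact hx
  | tail _ h _ =>
    obtain ⟨l, hl, -, hb⟩ := h
    exact hl.subset_ground hb

theorem IsLine.subset_component {l : Set α} (hl : IsLine M l) {x y : α} (hy : y ∈ l)
    (hyx : y ∈ component M x) : l ⊆ component M x :=
  fun _ hz => Relation.ReflTransGen.tail hyx ⟨l, hl, hy, hz⟩

theorem IsLine.nonempty {l : Set α} (hl : IsLine M l) : l.Nonempty := by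
  rw [nonempty_iff_ne_empty]
  rintro rfl
  exact hl.prop.1.not_indep M.empty_indep

/-- A line meeting a component is contained in it, so maximality in the restriction agrees with
maximality in `M`. -/
theorem isLine_restrict_component [Finite α] {x : α} (hx : x ∈ M.E) {l : Set α} :
    IsLine (M.restrict (component M x)) l ↔ IsLine M l ∧ l ⊆ component M x := by
  have hdep : ∀ t, (M.restrict (component M x)).Dep t ↔ M.Dep t ∧ t ⊆ component M x := by
    intro t
    rw [Matroid.restrict_dep_iff]
    refine and_congr_left fun ht => ?_
    rw [M.not_indep_iff (ht.trans (component_subset_ground hx))]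
  have hP : ∀ s, ((M.restrict (component M x)).Dep s ∧
      ∀ t ⊆ s, t.encard = 3 → (M.restrict (component M x)).Dep t) ↔
      (M.Dep s ∧ ∀ t ⊆ s, t.encard = 3 → M.Dep t) ∧ s ⊆ component M x := by
    intro s
    simp only [hdep]
    constructor
    · rintro ⟨⟨h1, h2⟩, h3⟩
      exact ⟨⟨h1, fun t ht h => (h3 t ht h).1⟩, h2⟩
    · rintro ⟨⟨h1, h2⟩, h3⟩
      exact ⟨⟨h1, h3⟩, fun t ht h => ⟨h2 t ht h, ht.trans h3⟩⟩
  constructor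
  · intro hl
    have hPl := (hP l).1 hl.prop
    obtain ⟨l', hll', hl'⟩ := (toFinite {s : Set α | M.Dep s ∧ ∀ t ⊆ s, t.encard = 3 → M.Dep t}
      ).exists_le_maximal hPl.1
    have hl'line : IsLine M l' := hl'
    obtain ⟨y, hy⟩ := hl.nonempty
    have hsub : l' ⊆ component M x := hl'line.subset_component (hll' hy) (hPl.2 hy)
    have e : l = l' := hl.eq_of_subset ((hP l').2 ⟨hl'.prop, hsub⟩) hll'
    exact ⟨e ▸ hl'line, hPl.2⟩
  · rintro ⟨hl, hsub⟩
    exact ⟨(hP l).2 ⟨hl.prop, hsub⟩, fun s hs hls => hl.le_of_ge ((hP s).1 hs).1 hls⟩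

theorem IsCactus.isCactusSet [Finite α] (hM : IsCactus M) :
    IsCactusSet (leviGraph α) (leviVertices M) := by
  obtain ⟨-, -, hcomp⟩ := hM
  have hinl : ∀ x y : α, Sum.inl y ∈ leviVertices (M.restrict (component M x)) ↔
      y ∈ component M x := by simp
  have hinr : ∀ x ∈ M.E, ∀ l, Sum.inr l ∈ leviVertices (M.restrict (component M x)) ↔
      IsLine M l ∧ l ⊆ component M x := by
    intro x hx l
    rw [inr_mem_leviVertices, isLine_restrict_component hx]
  have key : ∀ F : Set α, F.Finite → F ⊆ M.E → IsCactusSet (leviGraph α)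
      (⋃ x ∈ F, leviVertices (M.restrict (component M x))) := by
    intro F hF
    induction F, hF using Set.Finite.induction_on with
    | empty => intro _; simpa using IsCactusSet.empty
    | @insert a F ha hF ih =>
      intro hFE
      have haE : a ∈ M.E := hFE (Or.inl rfl)
      have hFE' : F ⊆ M.E := fun x hx => hFE (Or.inr hx)
      rw [biUnion_insert]
      -- Several points may represent the same component; a repeated component adds nothing, and a
      -- new one is disjoint from and nonadjacent to the earlier ones.
      by_cases hex : ∃ x ∈ F, component M x = component M a
      · obtain ⟨x, hx, he⟩ := hex
        rw [union_eq_self_of_subset_left]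
        · exact ih hFE'
        · rw [← he]
          exact subset_biUnion_of_mem (u := fun x => leviVertices (M.restrict (component M x))) hx
      · push Not at hex
        have hdisj : ∀ x ∈ F, ∀ y ∈ component M x, y ∉ component M a := fun x hx y h1 h2 =>
          hex x hx (by rw [← component_eq h1, component_eq h2])
        rw [union_comm]
        refine (ih hFE').union (hcomp a haE).isCactusSet ?_ ?_
        · intro u hu hua
          obtain ⟨x, hx, hux⟩ := mem_iUnion₂.1 hu
          rcases u with y | l
          · exact hdisj x hx y ((hinl _ _).1 hux) ((hinl _ _).1 hua)
          · have h1 := (hinr x (hFE' hx) l).1 hux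
            have h2 := (hinr a haE l).1 hua
            obtain ⟨y, hy⟩ := h1.1.nonempty
            exact hdisj x hx y (h1.2 hy) (h2.2 hy)
        · intro u hu v hv hadj
          obtain ⟨x, hx, hux⟩ := mem_iUnion₂.1 hu
          rcases u with y | l <;> rcases v with z | l'
          · simp at hadj
          · have h2 := (hinr a haE l').1 hv
            exact hdisj x hx y ((hinl _ _).1 hux) (h2.2 (by simpa using hadj))
          · have h1 := (hinr x (hFE' hx) l).1 hux
            exact hdisj x hx z (h1.2 (by simpa using hadj)) ((hinl _ _).1 hv)
          · simp at hadj
  convert key M.E (toFinite _) subset_rfl using 1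
  ext v
  rw [mem_iUnion₂]
  rcases v with y | l
  · rw [inl_mem_leviVertices]
    constructor
    · exact fun hy => ⟨y, hy, (hinl _ _).2 (mem_component_self y)⟩
    · rintro ⟨x, hx, h⟩
      exact component_subset_ground hx ((hinl _ _).1 h)
  · rw [inr_mem_leviVertices]
    constructor
    · intro hl
      obtain ⟨x, hx⟩ := hl.nonempty
      have hxE := hl.subset_ground hx
      exact ⟨x, hxE, (hinr x hxE l).2 ⟨hl, hl.subset_component hx (mem_component_self x)⟩⟩
    · rintro ⟨x, hx, h⟩
      exact ((hinr x hx l).1 h).1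

end Components

/-! ### Spanning families in `ℂ³` -/

section Spanning

variable {α : Type*} [Finite α] {γ : α → Fin 3 → ℂ} {I : Set α}

theorem encard_le_three_of_linearIndepOn (h : LinearIndepOn ℂ γ I) : I.encard ≤ 3 := by
  have := Fintype.ofFinite I
  have h1 := LinearIndependent.fintype_card_le_finrank (show LinearIndependent ℂ fun i : I => γ i
    from h)
  rw [Module.finrank_fin_fun] at h1
  rw [encard, ENat.card_eq_coe_fintype_card]
  exact_mod_cast h1

theorem span_eq_top_of_linearIndepOn (h : LinearIndepOn ℂ γ I) (h3 : I.encard = 3) :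
    Submodule.span ℂ (γ '' I) = ⊤ := by
  have := Fintype.ofFinite I
  rw [encard, ENat.card_eq_coe_fintype_card] at h3
  have h3' : Fintype.card I = 3 := by exact_mod_cast h3
  have h1 := LinearIndependent.span_eq_top_of_card_eq_finrank' (show LinearIndependent ℂ
    fun i : I => γ i from h) (by rw [h3', Module.finrank_fin_fun])
  rwa [image_eq_range]

theorem encard_eq_three_of_span_eq_top (h : LinearIndepOn ℂ γ I)
    (hs : Submodule.span ℂ (γ '' I) = ⊤) : I.encard = 3 := by
  have := Fintype.ofFinite I
  have hli : LinearIndependent ℂ fun i : I => γ i := h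
  rw [image_eq_range] at hs
  have h1 := Module.finrank_eq_card_basis (Module.Basis.mk hli hs.ge)
  rw [Module.finrank_fin_fun] at h1
  rw [encard, ENat.card_eq_coe_fintype_card, ← h1]
  rfl

theorem eq_zero_of_span_eq_top {s : Set (Fin 3 → ℂ)} (hs : Submodule.span ℂ s = ⊤)
    {h : Fin 3 → ℂ} (hh : ∀ v ∈ s, v ⬝ᵥ h = 0) : h = 0 := by
  have key : ∀ v ∈ Submodule.span ℂ s, v ⬝ᵥ h = 0 := by
    intro v hv
    induction hv using Submodule.span_induction with
    | mem v hv => exact hh v hv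
    | zero => simp
    | add u v _ _ hu hv => rw [add_dotProduct, hu, hv, add_zero]
    | smul c v _ hv => rw [smul_dotProduct, hv, smul_zero]
  funext i
  have := key (Pi.single i 1) (hs ▸ Submodule.mem_top)
  simpa using this

theorem exists_normal_of_span_ne_top {s : Set (Fin 3 → ℂ)} (hs : Submodule.span ℂ s ≠ ⊤) :
    ∃ h : Fin 3 → ℂ, h ≠ 0 ∧ ∀ v ∈ s, v ⬝ᵥ h = 0 := by
  obtain ⟨f, hf, hle⟩ := Submodule.exists_le_ker_of_lt_top _ (lt_top_iff_ne_top.2 hs)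
  have key : ∀ v, f v = v ⬝ᵥ fun i => f (Pi.single i 1) := fun v => by
    rw [LinearMap.pi_apply_eq_sum_univ f v]
    refine Finset.sum_congr rfl fun i _ => ?_
    rw [smul_eq_mul]
    congr 2
    funext j
    simp [Pi.single_apply, eq_comm]
  refine ⟨fun i => f (Pi.single i 1), fun h => hf ?_, fun v hv => ?_⟩
  · ext i
    simpa using congrFun h i
  · rw [← key]
    exact hle (Submodule.subset_span hv)

end Spanning

/-! ### Circuit varieties and matroid varieties -/

section Varieties

variable {α : Type*} {M : Matroid α} {J : Set α}

theorem isClosed_circuitVariety [Finite α] (M : Matroid α) : IsClosed (circuitVariety M) := by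
  have : circuitVariety M = ⋂ I ∈ {I | M.Dep I},
      {γ : Config α | LinearIndepOn ℂ (γ : α → Fin 3 → ℂ) I}ᶜ := by
    ext γ
    simp only [circuitVariety, mem_iInter, mem_compl_iff, mem_ofPred_eq]
    exact ⟨fun h I hI => h I hI.subset_ground hI, fun h I _ hI => h I hI⟩
  rw [this]
  exact isClosed_biInter fun I _ => (isOpen_linearIndepOn I).isClosed_compl

/-- Only three-element dependent sets matter: smaller sets are independent in `M`, larger families
in ℂ³ are always dependent, and each dependent triple lies on a line. Conversely, if the vectors on
a line spanned ℂ³, a basis among them would be a triple of that line, hence dependent in `M`. -/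
theorem IsSimple.mem_circuitVariety_iff [Finite α] (hM : IsSimple M) {γ : Config α} :
    γ ∈ circuitVariety M ↔
      ∀ l, IsLine M l → ∃ h : Fin 3 → ℂ, h ≠ 0 ∧ ∀ x ∈ l, γ x ⬝ᵥ h = 0 := by
  constructor
  · intro hγ l hl
    have hs : Submodule.span ℂ ((γ : α → Fin 3 → ℂ) '' l) ≠ ⊤ := by
      intro hs
      obtain ⟨b, hbl, -, hspan, hb⟩ := exists_linearIndepOn_extension
        (linearIndepOn_empty ℂ (γ : α → Fin 3 → ℂ)) (empty_subset l)
      have hs' : Submodule.span ℂ ((γ : α → Fin 3 → ℂ) '' b) = ⊤ :=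
        top_le_iff.1 (hs ▸ Submodule.span_le.2 hspan)
      have hdep := hl.prop.2 b hbl (encard_eq_three_of_span_eq_top hb hs')
      exact hγ b hdep.subset_ground hdep hb
    obtain ⟨h, h0, hh⟩ := exists_normal_of_span_ne_top hs
    exact ⟨h, h0, fun x hx => hh _ ⟨x, hx, rfl⟩⟩
  · intro h I _ hdep hI
    have h3 : I.encard = 3 := le_antisymm (encard_le_three_of_linearIndepOn hI)
      (Order.add_one_le_of_lt (hM.two_lt_encard hdep))
    obtain ⟨l, hl, hIl⟩ := exists_isLine_of_dep hdep h3
    obtain ⟨n, hn, hnl⟩ := h l hl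
    refine hn (eq_zero_of_span_eq_top (span_eq_top_of_linearIndepOn hI h3) ?_)
    rintro _ ⟨x, hx, rfl⟩
    exact hnl x (hIl hx)

/-- The configurations of the circuit variety whose zero vectors are those indexed by `J`. -/
def exactConfigs (M : Matroid α) (J : Set α) : Set (Config α) :=
  {γ | γ ∈ circuitVariety M ∧ ∀ v, γ v ≠ 0 ↔ v ∉ J}

open Classical in
theorem exactConfigs_eq_image [Finite α] (hE : M.E = univ) (hM : IsSimple M) (J : Set α) :
    exactConfigs M J = (fun f : Config (α ⊕ Set α) => (fun v => f (Sum.inl v) : Config α)) ''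
      realizations (leviGraph α) (leviVertices M \ Sum.inl '' J) := by
  ext γ
  constructor
  · rintro ⟨hγ, hJ⟩
    rw [hM.mem_circuitVariety_iff] at hγ
    choose! h h0 hh using hγ
    let f : Config (α ⊕ Set α) := Sum.elim γ fun l => if IsLine M l then h l else 0
    have hfr : ∀ l, f (Sum.inr l) = if IsLine M l then h l else 0 := fun _ => rfl
    have hfl : ∀ x, f (Sum.inl x) = γ x := fun _ => rfl
    have hadj : ∀ x l, x ∈ l → f (Sum.inl x) ⬝ᵥ f (Sum.inr l) = 0 := by
      intro x l hx
      rw [hfl, hfr]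
      by_cases hl : IsLine M l
      · rw [if_pos hl, hh l hl x hx]
      · rw [if_neg hl, dotProduct_zero]
    refine ⟨f, ⟨?_, ?_⟩, rfl⟩
    · rintro (x | l)
      · rw [hfl, hJ]; simp [hE]
      · rw [hfr]
        by_cases hl : IsLine M l
        · simp [hl, h0 l hl]
        · simp [hl]
    · rintro (x | l) (y | l') hxy
      · simp at hxy
      · exact hadj x l' (by simpa using hxy)
      · rw [dotProduct_comm]
        exact hadj y l (by simpa using hxy)
      · simp at hxy
  · rintro ⟨f, ⟨hf, hadj⟩, rfl⟩
    refine ⟨hM.mem_circuitVariety_iff.2 fun l hl => ⟨f (Sum.inr l), (hf _).2 ?_, fun x hx => ?_⟩,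
      fun v => ?_⟩
    · simpa using hl
    · exact hadj _ _ (by simpa using hx)
    · rw [hf]; simp [hE]

theorem IsCactus.isPreirreducible_exactConfigs [Finite α] (hE : M.E = univ) (hM : IsCactus M) (J : Set α) :
    IsPreirreducible (exactConfigs M J) := by
  rw [exactConfigs_eq_image hE hM.1]
  exact (hM.isCactusSet.diff _).isPreirreducible.image _
    (continuous_of_isPoly fun w i => IsPoly.coord (Sum.inl w) i).continuousOn

theorem exists_subset_pair_of_notMem_multiplePoints (hE : M.E = univ) {p : α}
    (hp : p ∉ multiplePoints M) : ∃ l₁ l₂, linesThrough M p ⊆ {l₁, l₂} := by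
  have h : (linesThrough M p).encard < 3 := by
    by_contra hc
    exact hp ⟨hE ▸ mem_univ p, not_lt.1 hc⟩
  have h2 : (linesThrough M p).encard ≤ 2 := Order.le_of_lt_add_one (by
    rwa [show (2 : ℕ∞) + 1 = 3 from rfl])
  rcases h2.lt_or_eq with h1 | h1
  · have h1 : (linesThrough M p).encard ≤ 1 :=
      Order.le_of_lt_add_one (by rwa [one_add_one_eq_two])
    rcases encard_le_one_iff_eq.1 h1 with h | ⟨l, h⟩
    · exact ⟨∅, ∅, by simp [h]⟩
    · exact ⟨l, l, by simp [h]⟩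
  · obtain ⟨l₁, l₂, -, h⟩ := encard_eq_two.1 h1
    exact ⟨l₁, l₂, h.le⟩

/-- A vanishing point outside `J` has degree at most two, so some nonzero vector is orthogonal to
the normals of all its lines. Moving each such point along this vector keeps the normals valid and
removes the unwanted zeros. -/
theorem mem_closure_exactConfigs [Finite α] (hE : M.E = univ) (hM : IsSimple M) {γ : Config α}
    (hγ : γ ∈ circuitVariety M) (hJ : ∀ v ∈ J, γ v = 0)
    (hQ : ∀ v ∈ multiplePoints M, v ∉ J → γ v ≠ 0) : γ ∈ closure (exactConfigs M J) := by
  have hγ' := hM.mem_circuitVariety_iff.1 hγ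
  choose! h h0 hh using hγ'
  have hw : ∀ v, ∃ w : Fin 3 → ℂ, (∀ l, IsLine M l → v ∈ l → w ⬝ᵥ h l = 0) ∧
      ((γ v = 0 ∧ v ∉ J) → w ≠ 0) ∧ (¬ (γ v = 0 ∧ v ∉ J) → w = 0) := by
    intro v
    by_cases hv : γ v = 0 ∧ v ∉ J
    · have hvQ : v ∉ multiplePoints M := fun hvQ => hQ v hvQ hv.2 hv.1
      obtain ⟨l₁, l₂, hl⟩ := exists_subset_pair_of_notMem_multiplePoints hE hvQ
      obtain ⟨w, hw0, hw1, hw2⟩ := exists_perp_pair (h l₁) (h l₂)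
      refine ⟨w, fun l hl' hvl => ?_, fun _ => hw0, fun hc => absurd hv hc⟩
      rw [dotProduct_comm]
      rcases hl (show l ∈ linesThrough M v from ⟨hl', hvl⟩) with rfl | rfl
      · exact hw1
      · exact hw2
    · exact ⟨0, fun _ _ _ => zero_dotProduct _, fun hc => absurd hc hv, fun _ => rfl⟩
  choose w hw1 hw2 hw3 using hw
  let c : ℂ → α → Fin 3 → ℂ := fun t v => γ v + t • w v
  have hcont : Continuous c := by
    refine continuous_pi fun v => ?_
    exact continuous_const.add (continuous_id.smul continuous_const)
  have hc0 : c 0 = γ := by funext v; simp [c]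
  have key := mem_closure_of_curve (A := exactConfigs M J) c hcont (by
    filter_upwards [self_mem_nhdsWithin] with t ht
    refine ⟨hM.mem_circuitVariety_iff.2 fun l hl => ⟨h l, h0 l hl, fun x hx => ?_⟩, fun v => ?_⟩
    · rw [add_dotProduct, hh l hl x hx, smul_dotProduct, hw1 x l hl hx, smul_zero, add_zero]
    · by_cases hv : γ v = 0 ∧ v ∉ J
      · refine iff_of_true ?_ hv.2
        simp only [c, hv.1, zero_add]
        exact smul_ne_zero ht (hw2 v hv)
      · simp only [c, hw3 v hv, smul_zero, add_zero]
        by_cases hvJ : v ∈ J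
        · exact iff_of_false (not_not.2 (hJ v hvJ)) (not_not.2 hvJ)
        · exact iff_of_true (fun hc => hv ⟨hc, hvJ⟩) hvJ)
  rwa [hc0] at key

theorem realizationSpace_setLoops (hE : M.E = univ) (hM : IsSimple M) (J : Set α) :
    realizationSpace (setLoops M J) = exactConfigs M J ∩
      ⋂ I ∈ {I | M.Indep I ∧ Disjoint I J},
        {γ : Config α | LinearIndepOn ℂ (γ : α → Fin 3 → ℂ) I} := by
  have hdep : ∀ I, (setLoops M J).Dep I ↔ ¬ (M.Indep I ∧ Disjoint I J) := by
    intro I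
    rw [← Matroid.not_indep_iff (by rw [setLoops_ground, hE]; exact subset_univ _),
      setLoops_indep_iff]
  ext γ
  simp only [realizationSpace, exactConfigs, mem_inter_iff, mem_iInter, mem_ofPred_eq,
    setLoops_ground, hE, subset_univ, forall_const, hdep, not_iff_not]
  constructor
  · intro h
    refine ⟨⟨fun I _ hI hli => hI.not_indep ((h I).2 hli).1, fun v => ?_⟩, fun I hI => (h I).1 hI⟩
    -- The condition on singletons already forces the zero vectors to be exactly those indexed by
    -- `J`.
    have hv : M.Indep {v} := hM.indep_of_encard_le (by rw [hE]; exact subset_univ _)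
      (by rw [encard_singleton]; decide)
    have h1 := h {v}
    rw [disjoint_singleton_left, and_iff_right hv] at h1
    rw [← not_iff_not, h1]
    exact (linearIndepOn_singleton_iff ℂ).symm
  · rintro ⟨⟨h1, h2⟩, h3⟩ I
    refine ⟨h3 I, fun hli => ⟨?_, ?_⟩⟩
    · by_contra hc
      have hd : M.Dep I := (M.not_indep_iff (by rw [hE]; exact subset_univ _)).1 hc
      exact h1 I hd.subset_ground hd hli
    · rw [disjoint_left]
      intro v hv
      exact fun hvJ => hli.ne_zero hv ((h2 v).2 hvJ)

end Varieties

/-! ### Realizability and irreducibility -/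

section Realizability

variable {α : Type*} {M : Matroid α} {J : Set α}

open Classical in
/-- An independent set of a simple matroid of rank at most three can be coloured injectively by
three colours, extended to all points in such a way that no line meets all three colours. -/
theorem IsSimple.exists_colouring (hM : IsSimple M) (hr : M.eRank ≤ 3) {I : Set α}
    (hI : M.Indep I) :
    ∃ c : α → Fin 3, InjOn c I ∧ ∀ l, IsLine M l → ∃ i, ∀ x ∈ l, c x ≠ i := by
  rcases (hI.encard_le_eRank.trans hr).lt_or_eq with h | h
  · have h2 : I.encard ≤ 2 := Order.le_of_lt_add_one (by rwa [show (2 : ℕ∞) + 1 = 3 from rfl])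
    rcases h2.lt_or_eq with h1 | h1
    · have h1 : I.encard ≤ 1 := Order.le_of_lt_add_one (by rwa [one_add_one_eq_two])
      exact ⟨fun _ => 0, fun x hx y hy _ => encard_le_one_iff.1 h1 x y hx hy,
        fun l _ => ⟨1, fun x _ => zero_ne_one⟩⟩
    · obtain ⟨p, q, hpq, rfl⟩ := encard_eq_two.1 h1
      refine ⟨fun x => if x = q then 1 else 0, ?_, fun l _ => ⟨2, fun x _ => ?_⟩⟩
      · rintro x (rfl | rfl) y (rfl | rfl) hxy <;> simp_all
      · by_cases hx : x = q <;> simp [hx]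
  · obtain ⟨p, q, r, hpq, hpr, hqr, rfl⟩ := encard_eq_three.1 h
    have hnl : ∀ l, IsLine M l → p ∈ l → q ∈ l → r ∈ l → False := fun l hl h1 h2 h3 =>
      (hl.prop.2 {p, q, r} (insert_subset h1 (pair_subset h2 h3)) h).not_indep hI
    -- The point `r` has colour 2, `q` and the rest of the line through `q` and `r` have colour 1,
    -- all others colour 0. That line misses 0, other lines through `r` miss 1, and lines avoiding
    -- `r` miss 2.
    let c : α → Fin 3 := fun x =>
      if x = r then 2 else if x = q ∨ ∃ l, IsLine M l ∧ q ∈ l ∧ r ∈ l ∧ x ∈ l then 1 else 0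
    have hcr : c r = 2 := by simp [c]
    have hcq : c q = 1 := by simp [c, hqr]
    have hcp : c p = 0 := by
      have : ¬ (p = q ∨ ∃ l, IsLine M l ∧ q ∈ l ∧ r ∈ l ∧ p ∈ l) := by
        rintro (h | ⟨l, hl, h1, h2, h3⟩)
        · exact hpq h
        · exact hnl l hl h3 h1 h2
      simp [c, hpr, this]
    refine ⟨c, ?_, fun l hl => ?_⟩
    · rintro x (rfl | rfl | rfl) y (rfl | rfl | rfl) hxy <;> simp_all
    · by_cases hrl : r ∈ l
      · by_cases hql : q ∈ l
        · refine ⟨0, fun x hx => ?_⟩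
          have : x = q ∨ ∃ l, IsLine M l ∧ q ∈ l ∧ r ∈ l ∧ x ∈ l := Or.inr ⟨l, hl, hql, hrl, hx⟩
          by_cases hxr : x = r <;> simp [c, hxr, this]
        · refine ⟨1, fun x hx => ?_⟩
          by_cases hxr : x = r
          · rw [hxr, hcr]; decide
          · have : ¬ (x = q ∨ ∃ l, IsLine M l ∧ q ∈ l ∧ r ∈ l ∧ x ∈ l) := by
              rintro (rfl | ⟨l', hl', h1, h2, h3⟩)
              · exact hql hx
              · exact hql (hM.isLine_eq hl hl' hxr hx hrl h3 h2 ▸ h1)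
            simp [c, hxr, this]
      · refine ⟨2, fun x hx => ?_⟩
        have hxr : x ≠ r := by rintro rfl; exact hrl hx
        simp only [c, hxr, if_false]
        split_ifs <;> decide

-- Points outside `J` get the coordinate vector of their colour; the coordinate vector of a colour
-- missing on a line is a normal to that line.
open Classical in
theorem IsSimple.exists_exactConfigs_linearIndepOn [Finite α] (hM : IsSimple M) (hr : M.eRank ≤ 3)
    {I : Set α} (hI : M.Indep I) (hIJ : Disjoint I J) :
    (exactConfigs M J ∩ {γ : Config α | LinearIndepOn ℂ (γ : α → Fin 3 → ℂ) I}).Nonempty := by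
  obtain ⟨c, hc, hl⟩ := hM.exists_colouring hr hI
  let γ : Config α := fun v => if v ∈ J then 0 else Pi.single (c v) 1
  refine ⟨γ, ⟨hM.mem_circuitVariety_iff.2 fun l hl' => ?_, fun v => ?_⟩, ?_⟩
  · obtain ⟨i, hi⟩ := hl l hl'
    refine ⟨Pi.single i 1, by simp, fun x hx => ?_⟩
    by_cases hxJ : x ∈ J
    · simp [γ, hxJ]
    · simp [γ, hxJ, (hi x hx).symm]
  · by_cases hv : v ∈ J <;> simp [γ, hv]
  · have hb : LinearIndependent ℂ fun x : I => (Pi.single (c x) 1 : Fin 3 → ℂ) := by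
      have := (Pi.basisFun ℂ (Fin 3)).linearIndependent.comp (fun x : I => c x)
        (injOn_iff_injective.1 hc)
      simpa [Function.comp_def] using this
    have e : (fun x : I => γ x) = fun x : I => (Pi.single (c x) 1 : Fin 3 → ℂ) := by
      funext x
      have : (x : α) ∉ J := disjoint_left.1 hIJ x.2
      simp [γ, this]
    change LinearIndependent ℂ fun x : I => γ x
    rwa [e]

theorem _root_.IsPreirreducible.inter_biInter_nonempty {T ι : Type*} [TopologicalSpace T]
    {X : Set T} (hX : IsPreirreducible X) (h0 : X.Nonempty) {s : Set ι} (hs : s.Finite)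
    {U : ι → Set T} (hU : ∀ i ∈ s, IsOpen (U i)) (hne : ∀ i ∈ s, (X ∩ U i).Nonempty) :
    (X ∩ ⋂ i ∈ s, U i).Nonempty := by
  induction s, hs using Set.Finite.induction_on with
  | empty => simpa using h0
  | @insert a s ha hs ih =>
    rw [biInter_insert]
    exact hX _ _ (hU a (Or.inl rfl)) (hs.isOpen_biInter fun i hi => hU i (Or.inr hi))
      (hne a (Or.inl rfl)) (ih (fun i hi => hU i (Or.inr hi)) fun i hi => hne i (Or.inr hi))

/-- No realization is constructed directly: different independent sets use different configurations,
and irreducibility of `exactConfigs M J` makes the finitely many nonempty open conditions meet. -/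
theorem IsCactus.isIrreducible_realizationSpace [Finite α] (hE : M.E = univ) (hM : IsCactus M)
    (J : Set α) : IsIrreducible (realizationSpace (setLoops M J)) := by
  rw [realizationSpace_setLoops hE hM.1]
  have hX := hM.isPreirreducible_exactConfigs hE J
  have hne : ∀ I ∈ {I | M.Indep I ∧ Disjoint I J},
      (exactConfigs M J ∩ {γ : Config α | LinearIndepOn ℂ (γ : α → Fin 3 → ℂ) I}).Nonempty :=
    fun I hI => hM.1.exists_exactConfigs_linearIndepOn hM.2.1 hI.1 hI.2
  exact ⟨hX.inter_biInter_nonempty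
      ((hne ∅ ⟨M.empty_indep, empty_disjoint J⟩).mono inter_subset_left) (toFinite _)
      (fun I _ => isOpen_linearIndepOn I) hne,
    IsPreirreducible.inter_isOpen hX
      ((toFinite _).isOpen_biInter fun I _ => isOpen_linearIndepOn I)⟩

theorem IsCactus.exactConfigs_subset_matroidVariety [Finite α] (hE : M.E = univ)
    (hM : IsCactus M) (J : Set α) : exactConfigs M J ⊆ matroidVariety (setLoops M J) := by
  have hne := (hM.isIrreducible_realizationSpace hE J).nonempty
  rw [matroidVariety, realizationSpace_setLoops hE hM.1] at *
  exact subset_closure_inter_of_isPreirreducible_of_isOpen (hM.isPreirreducible_exactConfigs hE J)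
    ((toFinite _).isOpen_biInter fun I _ => isOpen_linearIndepOn I) hne

theorem matroidVariety_setLoops_subset [Finite α] (hE : M.E = univ) (hM : IsSimple M) (J : Set α) :
    matroidVariety (setLoops M J) ⊆ circuitVariety M := by
  refine closure_minimal ?_ (isClosed_circuitVariety M)
  rw [realizationSpace_setLoops hE hM]
  exact fun γ hγ => hγ.1.1

theorem IsCactus.circuitVariety_eq [Finite α] (hE : M.E = univ) (hM : IsCactus M) :
    circuitVariety M = ⋃ J ∈ powerset (multiplePoints M), matroidVariety (setLoops M J) := by
  apply subset_antisymm
  · intro γ hγ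
    -- Only zeros at points of degree at least three are recorded in `J`; the others can be
    -- perturbed away.
    refine mem_iUnion₂.2 ⟨{v | v ∈ multiplePoints M ∧ γ v = 0}, fun v hv => hv.1, ?_⟩
    have h := mem_closure_exactConfigs hE hM.1 hγ
      (J := {v | v ∈ multiplePoints M ∧ γ v = 0}) (fun v hv => hv.2) fun v hv hv' h0 => hv' ⟨hv, h0⟩
    exact closure_minimal (hM.exactConfigs_subset_matroidVariety hE _) isClosed_closure h
  · exact iUnion₂_subset fun J _ => matroidVariety_setLoops_subset hE hM.1 J

end Realizability

/-! ### Irreducible components of a finite union of irreducible closed sets -/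

theorem isIrreducible_of_image_val {T : Type*} [TopologicalSpace T] {V : Set T} {Y : Set V}
    (h : IsIrreducible (Subtype.val '' Y)) : IsIrreducible Y := by
  refine ⟨image_nonempty.1 h.1, ?_⟩
  rintro _ _ ⟨U₁, h₁, rfl⟩ ⟨U₂, h₂, rfl⟩ ⟨x, hx, hx₁⟩ ⟨y, hy, hy₂⟩
  obtain ⟨_, ⟨z, hz, rfl⟩, hz₁, hz₂⟩ := h.2 U₁ U₂ h₁ h₂ ⟨x, ⟨x, hx, rfl⟩, hx₁⟩
    ⟨y, ⟨y, hy, rfl⟩, hy₂⟩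
  exact ⟨z, hz, hz₁, hz₂⟩

/-- A component is irreducible, so it lies in one of the finitely many closed sets; that set is
itself irreducible, so maximality gives equality. -/
theorem exists_eq_of_mem_components {α ι : Type*} {V : Set (Config α)} {s : Set ι}
    (hs : s.Finite) {W : ι → Set (Config α)} (hV : V = ⋃ i ∈ s, W i)
    (hW : ∀ i ∈ s, IsIrreducible (W i)) (hc : ∀ i ∈ s, IsClosed (W i)) {Z : Set (Config α)}
    (hZ : Z ∈ components V) : ∃ i ∈ s, Z = W i := by
  classical
  obtain ⟨Y, hY, rfl⟩ := hZ
  have hirr : IsIrreducible (Subtype.val '' Y : Set (Config α)) :=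
    hY.prop.image _ continuous_subtype_val.continuousOn
  obtain ⟨z, hz, hle⟩ := isIrreducible_iff_sUnion_isClosed.1 hirr
    (hs.image W).toFinset (by simpa using hc) (by
      rw [Finite.coe_toFinset, sUnion_image, ← hV]
      exact Subtype.coe_image_subset V Y)
  obtain ⟨i, hi, rfl⟩ : ∃ i ∈ s, W i = z := by simpa using hz
  refine ⟨i, hi, ?_⟩
  have hWV : W i ⊆ V := hV ▸ subset_biUnion_of_mem hi
  have himg : (Subtype.val '' (Subtype.val ⁻¹' W i : Set V) : Set (Config α)) = W i := by
    rw [Subtype.image_preimage_coe, inter_eq_right.2 hWV]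
  have hpre : IsIrreducible (Subtype.val ⁻¹' W i : Set V) := by
    refine isIrreducible_of_image_val ?_
    rw [himg]
    exact hW i hi
  have hYW : Y = Subtype.val ⁻¹' W i := hY.eq_of_subset hpre fun y hy => hle ⟨y, hy, rfl⟩
  rw [hYW]
  exact himg

end PointLine

theorem mainTheorem5 (d : ℕ) (M : Matroid (Fin d)) (hE : M.E = Set.univ)
    (hM : PointLine.IsCactus M) :
    PointLine.circuitVariety M =
        ⋃ J ∈ Set.powerset (PointLine.multiplePoints M),
          PointLine.matroidVariety (PointLine.setLoops M J) ∧
      (∀ Z ∈ PointLine.components (PointLine.circuitVariety M),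
        ∃ J ⊆ PointLine.multiplePoints M,
          Z = PointLine.matroidVariety (PointLine.setLoops M J)) ∧
      (PointLine.components (PointLine.circuitVariety M)).encard ≤
        2 ^ (PointLine.multiplePoints M).ncard := by
  have hV := hM.circuitVariety_eq hE
  have hcomp : ∀ Z ∈ PointLine.components (PointLine.circuitVariety M),
      ∃ J ∈ Set.powerset (PointLine.multiplePoints M),
        Z = PointLine.matroidVariety (PointLine.setLoops M J) := fun Z hZ =>
    PointLine.exists_eq_of_mem_components (Set.toFinite _) hV
      (fun J _ => (hM.isIrreducible_realizationSpace hE J).closure)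
      (fun J _ => isClosed_closure) hZ
  refine ⟨hV, hcomp, ?_⟩
  have hsub : PointLine.components (PointLine.circuitVariety M) ⊆
      (fun J => PointLine.matroidVariety (PointLine.setLoops M J)) ''
        Set.powerset (PointLine.multiplePoints M) := fun Z hZ => by
    obtain ⟨J, hJ, rfl⟩ := hcomp Z hZ
    exact ⟨J, hJ, rfl⟩
  refine (Set.encard_le_encard hsub).trans ((Set.encard_image_le _ _).trans ?_)
  rw [← (Set.toFinite (Set.powerset (PointLine.multiplePoints M))).cast_ncard_eq,
    Set.ncard_powerset]
  simp
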